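/- **Setting.** A register is a finite-dimensional complex Hilbert space with a fixed orthonormal basis. A *Bell game* $G$ with alphabet size $n\ge 1$ is a two-player game whose input and output alphabets all equal $\{0,\dots,n-1\}$, whose inputs $(x,y)$ are uniformly distributed, whose score $L(x,y,s,t)$ lies in $[-1,1]$, and whose optimal classical expected score is $0$. An $N$-fold measurement strategy on a register $AB$ is a family of POVMs $\{F_{\mathbf u}^{\mathbf t}\}_{\mathbf t}$, one for each input string $\mathbf u=((x_1,y_1),\dots,(x_N,y_N))$, with outcomes the output strings $\mathbf t=((s_1,t_1),\dots,(s_N,t_N))$. It is *sequential* if, for every $i$, the operator $F_{\mathbf u}^{t_1\cdots t_i}$ obtained by summing over the last $N-i$ outputs depends only on the first $i$ inputs. For a history of $i<N$ rounds whose operator $M$ is nonzero, the *conditional strategy* of the next round is $M^{-1/2}M'M^{-1/2}$, where $M'$ is the operator of the history extended by the next input and output pairs and the inverse is taken on the support of $M$. A sequential strategy is *bipartite* if every conditional strategy has, on the support of $M$, the form $P_x^{s}\otimes R_y^{t}$ with POVMs $\{P_x^s\}_s$ on $A$ and $\{R_y^t\}_t$ on $B$ (compressed to that support). **Mirrored protocol.**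 Let $\delta>0$, $N\ge1$, let $G$ be a Bell game with alphabet size $n$, let $\Sigma$ be a state of $AB$, and let $F$ be a bipartite sequential measurement strategy on $AB$ for $N$ rounds of $G$. Registers $ABA'B'$ are prepared in the canonical purification of $\Sigma$, that is, in the pure state $(\sqrt{\Sigma}\otimes I)\sum_e e\otimes e$ (the sum is over the basis of $AB$). The input registers $\mathbf X,\mathbf Y$ of the referee are prepared in Bell states with copies $\mathbf X',\mathbf Y'$, which are given to the adversary. The referee measures $\mathbf X,\mathbf Y$ in the standard basis, and the devices measure $AB$ with $F$ on these inputs, producing outputs $\mathbf S,\mathbf T$; the event $succ$ is that the average score over the $N$ rounds is greater than $\delta$. The adversary measures $\mathbf X',\mathbf Y'$ in the standard basis and measures $A'B'$ with the entrywise complex conjugate $\overline F$ of $F$ on the inputs she obtained, producing outputs $\mathbf S',\mathbf T'$; the event $succ'$ is that her average score is at least $\delta$. **Proposition.** There is a universal constant $c>0$ such that, for all such $n,G,\delta,N,A,B,\Sigma,F$, $$\mathbf P\bigl((\mathbf S=\mathbf S')\wedge succ\wedge succ'\bigr)\le \exp\!\left(-c\,\frac{N\delta^6}{n^4}\right).$$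 -/

import Mathlib

noncomputable section

namespace MirrorProtocol

open scoped Kronecker Matrix ComplexOrder

/-! ### Games -/

/-- Expected score, for uniformly random inputs, of the deterministic strategy in which the first
player answers `f x` and the second player answers `g y`. -/
def classicalScore {n : ℕ} (L : Fin n → Fin n → Fin n → Fin n → ℝ) (f g : Fin n → Fin n) : ℝ :=
  (∑ x, ∑ y, L x y (f x) (g y)) / (n : ℝ) ^ 2

/-- A two-player Bell game with alphabet size `n`: all input and output alphabets are
`{0, …, n - 1}`, the inputs are uniform, `score x y s t` is the score of the outputs `s, t` on the
inputs `x, y` and lies in `[-1, 1]`, and the optimal classical score is `0`.  (A randomized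
classical strategy is a mixture of deterministic ones, so the optimum is attained at a
deterministic one.) -/
structure BellGame (n : ℕ) where
  score : Fin n → Fin n → Fin n → Fin n → ℝ
  score_mem : ∀ x y s t, score x y s t ∈ Set.Icc (-1 : ℝ) 1
  classical_optimum :
    IsGreatest {v : ℝ | ∃ f g : Fin n → Fin n, v = classicalScore score f g} 0

/-! ### States and measurements

A register is the Hilbert space with a fixed orthonormal basis indexed by a finite type `Q`; its
operators are the matrices `Matrix Q Q ℂ`, and the tensor product of the registers `Q` and `Q'` is
the register `Q × Q'`. -/

/-- `ρ` is a density operator. -/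
structure IsState {Q : Type*} [Fintype Q] (ρ : Matrix Q Q ℂ) : Prop where
  posSemidef : ρ.PosSemidef
  trace_eq_one : ρ.trace = 1

/-- `P` is a positive operator-valued measure with outcomes in `T`. -/
structure IsMeasurement {Q T : Type*} [Fintype Q] [DecidableEq Q] [Fintype T]
    (P : T → Matrix Q Q ℂ) : Prop where
  posSemidef : ∀ t, (P t).PosSemidef
  sum_eq_one : ∑ t, P t = 1

section Strategies

variable {Q U T : Type*} [Fintype Q] [DecidableEq Q] [Fintype T] [DecidableEq T] {N : ℕ}

/-- `F^{t₁ ⋯ tᵢ}_u`: the sum of `F u t'` over all output strings `t'` that agree with `t` in the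
first `i` rounds. -/
def marginal (F : (Fin N → U) → (Fin N → T) → Matrix Q Q ℂ) (i : ℕ)
    (u : Fin N → U) (t : Fin N → T) : Matrix Q Q ℂ :=
  ∑ t' : Fin N → T with ∀ j : Fin N, (j : ℕ) < i → t' j = t j, F u t'

/-- `F` is an `N`-fold sequential measurement strategy: a family of measurements, one for each
input string `u`, such that the operators for the first `i` outputs depend on the first `i` inputs
only. -/
structure IsSequential (F : (Fin N → U) → (Fin N → T) → Matrix Q Q ℂ) : Prop where
  isMeasurement : ∀ u, IsMeasurement (F u)
  nonanticipating : ∀ (i : ℕ) (u u' : Fin N → U), (∀ j : Fin N, (j : ℕ) < i → u j = u' j) →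
    ∀ t, marginal F i u t = marginal F i u' t

/-- `M^{-1/2}` for a positive semidefinite `M`, taken on the support of `M` (so it vanishes on the
kernel of `M`). -/
def invSqrt (M : Matrix Q Q ℂ) : Matrix Q Q ℂ := cfc (fun x : ℝ => (Real.sqrt x)⁻¹) M

/-- The orthogonal projector onto the support of a positive semidefinite `M`. -/
def supportProj (M : Matrix Q Q ℂ) : Matrix Q Q ℂ :=
  cfc (fun x : ℝ => if x = 0 then (0 : ℝ) else 1) M

/-- The conditional strategy for round `i` (counted from `0`), given the inputs and outputs
recorded in `u` and `t` for the earlier rounds: the operator for input `v` and output `w` is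
`M^{-1/2} M' M^{-1/2}`, where `M` is the operator for the first `i` rounds and `M'` is the one for
the first `i + 1` rounds. -/
def conditional (F : (Fin N → U) → (Fin N → T) → Matrix Q Q ℂ) (i : Fin N)
    (u : Fin N → U) (t : Fin N → T) (v : U) (w : T) : Matrix Q Q ℂ :=
  invSqrt (marginal F i u t) *
    marginal F (i + 1) (Function.update u i v) (Function.update t i w) *
    invSqrt (marginal F i u t)

end Strategies

section Protocol

variable {n N : ℕ}

/-- `F` is a bipartite sequential measurement strategy on the register `AB` for the `N`-fold game:
it is sequential and all its conditional strategies are bipartite.  A conditional strategy is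
a measurement on the support of the operator `M` of the history, so being bipartite means
being given there by `P x s ⊗ R y t` for measurements `P x` of `A` and `R y` of `B`. -/
structure IsBipartiteSequential {A B : Type*} [Fintype A] [DecidableEq A] [Fintype B]
    [DecidableEq B]
    (F : (Fin N → Fin n × Fin n) → (Fin N → Fin n × Fin n) → Matrix (A × B) (A × B) ℂ) :
    Prop where
  isSequential : IsSequential F
  bipartite : ∀ (i : Fin N) (u t : Fin N → Fin n × Fin n), marginal F i u t ≠ 0 →
    ∃ (P : Fin n → Fin n → Matrix A A ℂ) (R : Fin n → Fin n → Matrix B B ℂ),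
      (∀ x, IsMeasurement (P x)) ∧ (∀ y, IsMeasurement (R y)) ∧
      ∀ x y s t', conditional F i u t (x, y) (s, t') =
        supportProj (marginal F i u t) * (P x s ⊗ₖ R y t') * supportProj (marginal F i u t)

variable {Q : Type*} [Fintype Q] [DecidableEq Q]

/-- The unnormalized vector `∑ₑ e ⊗ e` of two copies of the register `Q`. -/
def diagVec (Q : Type*) [DecidableEq Q] : Q × Q → ℂ := fun p => if p.1 = p.2 then 1 else 0

/-- The canonical purification of a state `ρ` of `Q`: the projector onto the line spanned by the
unit vector `(√ρ ⊗ I) ∑ₑ e ⊗ e`. -/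
def canonicalPurification (ρ : Matrix Q Q ℂ) : Matrix (Q × Q) (Q × Q) ℂ :=
  let v := (cfc Real.sqrt ρ ⊗ₖ (1 : Matrix Q Q ℂ)) *ᵥ diagVec Q
  Matrix.vecMulVec v (star v)

/-- The Bell state (maximally entangled state) of two copies of the register `Q`. -/
def bellState (Q : Type*) [Fintype Q] [DecidableEq Q] : Matrix (Q × Q) (Q × Q) ℂ :=
  (Fintype.card Q : ℂ)⁻¹ • Matrix.vecMulVec (diagVec Q) (star (diagVec Q))

/-- The pairs of inputs, respectively of outputs, of the `N` rounds: `u i = (xᵢ, yᵢ)`,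
respectively `t i = (sᵢ, tᵢ)`. -/
abbrev Pairs (n N : ℕ) := Fin N → Fin n × Fin n

/-- The classical record of the protocol: the inputs and outputs `(x, y)` and `(s, t)` on the
devices' side, and those on the adversary's side. -/
structure Record (n N : ℕ) where
  inp : Pairs n N
  out : Pairs n N
  inp' : Pairs n N
  out' : Pairs n N

instance : Fintype (Record n N) :=
  Fintype.ofEquiv ((Pairs n N × Pairs n N) × (Pairs n N × Pairs n N))
    { toFun := fun p => ⟨p.1.1, p.1.2, p.2.1, p.2.2⟩
      invFun := fun r => ((r.inp, r.out), (r.inp', r.out'))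
      left_inv := fun _ => rfl
      right_inv := fun _ => rfl }

/-- The initial state: the input registers `XY` and their copies `X'Y'` are in a Bell state (all
the Bell pairs together form one Bell state of the whole strings), and `ABA'B'` is in the canonical
purification of `ρ`. -/
def initialState (n N : ℕ) (ρ : Matrix Q Q ℂ) :
    Matrix ((Pairs n N × Pairs n N) × (Q × Q)) ((Pairs n N × Pairs n N) × (Q × Q)) ℂ :=
  bellState (Pairs n N) ⊗ₖ canonicalPurification ρ

/-- The effect of a record: `XY` and `X'Y'` are measured in the standard basis, the devices measure
`AB` with `F` on the inputs of the referee, and the adversary measures `A'B'` with the entrywise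
complex conjugate of `F` on her inputs. -/
def recordEffect (F : Pairs n N → Pairs n N → Matrix Q Q ℂ) (r : Record n N) :
    Matrix ((Pairs n N × Pairs n N) × (Q × Q)) ((Pairs n N × Pairs n N) × (Q × Q)) ℂ :=
  (Matrix.single r.inp r.inp 1 ⊗ₖ Matrix.single r.inp' r.inp' 1) ⊗ₖ
    (F r.inp r.out ⊗ₖ (F r.inp' r.out').map (starRingEnd ℂ))

/-- The probability of a record in the mirrored protocol. -/
def recordProb (ρ : Matrix Q Q ℂ) (F : Pairs n N → Pairs n N → Matrix Q Q ℂ)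
    (r : Record n N) : ℝ :=
  (recordEffect F r * initialState n N ρ).trace.re

open Classical in
/-- The probability of an event `E` in the mirrored protocol. -/
def prob (ρ : Matrix Q Q ℂ) (F : Pairs n N → Pairs n N → Matrix Q Q ℂ)
    (E : Record n N → Prop) : ℝ :=
  ∑ r : Record n N with E r, recordProb ρ F r

/-- The average score over the `N` rounds. -/
def averageScore (G : BellGame n) (u t : Pairs n N) : ℝ :=
  (∑ i, G.score (u i).1 (u i).2 (t i).1 (t i).2) / N

/-- The referee considers the protocol to have succeeded: the average score exceeds `δ`. -/
def RefereeSucc (G : BellGame n) (δ : ℝ) (r : Record n N) : Prop :=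
  δ < averageScore G r.inp r.out

/-- The adversary considers the protocol to have succeeded: her average score is not less than
`δ`. -/
def AdversarySucc (G : BellGame n) (δ : ℝ) (r : Record n N) : Prop :=
  δ ≤ averageScore G r.inp' r.out'

/-- Alice's output string `s` equals the adversary's copy `s'` of it. -/
def SameOutput (r : Record n N) : Prop :=
  ∀ i, (r.out i).1 = (r.out' i).1

end Protocol

end MirrorProtocol

end

/-!
The Bell states force the referee and the adversary to use the same inputs, so the record is a
history of `N` rounds in which `F` and its conjugate are measured side by side on a pure state.

Consider one round, in which Alice and the adversary's mirror of her use Kraus operators `a` on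
`A` and `b` on `A'`. Since `a² ⊗ b² ≤ a ⊗ b`, the squared distance between `a` and `b`, as applied
to the state, is at most twice the probability that their outcomes differ. When disagreement is
unlikely, measuring `b` therefore disturbs `A'B` hardly more than measuring `a`, which does not
disturb it at all, and the measurements `b` for *all* inputs of Alice can be performed one after
another. The list of their outcomes answers every input in advance, so this is a classical
strategy, and its expected score is nonpositive. Consequently a positive expected score on the
event of agreement must be paid for by a probability of disagreement, and the exponential moment
`E[exp (l (score - δ)); agreement]` of a round is at most `1 - δ² / (32 n²)` for
`l = δ / (16 n²)`. These bounds multiply over the rounds, and Markov's inequality concludes.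
-/

noncomputable section

namespace MirrorProtocol

open scoped Kronecker Matrix ComplexOrder

section Kraus

variable {S T : Type*}

section Monoid

variable {𝒜 : Type*} [Monoid 𝒜]

/-- The Kraus operators of measuring `b` first and `r` second. -/
def productKraus (r : T → 𝒜) (b : S → 𝒜) : S × T → 𝒜 := fun p => r p.2 * b p.1

/-- The Kraus operators of the sequential measurement of `b 0`, `b 1`, …, whose outcome is the
string of all the individual outcomes. -/
def sequentialKraus : {k : ℕ} → (Fin k → S → 𝒜) → (Fin k → S) → 𝒜
  | 0, _, _ => 1
  | _ + 1, b, f => sequentialKraus (Fin.tail b) (Fin.tail f) * b 0 (f 0)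

lemma commute_sequentialKraus {k : ℕ} {x : 𝒜} {b : Fin k → S → 𝒜}
    (h : ∀ i s, Commute x (b i s)) (f : Fin k → S) : Commute x (sequentialKraus b f) := by
  induction k with
  | zero => exact Commute.one_right x
  | succ k ih => exact (ih (fun i => h i.succ) (Fin.tail f)).mul_right (h 0 (f 0))

end Monoid

variable {𝒜 : Type*} [Semiring 𝒜] [StarRing 𝒜]

/-- The Kraus operators `a` of a Lüders measurement: they are self-adjoint and the associated
effects `a s ^ 2` add up to the identity. -/
structure IsLuders [Fintype S] (a : S → 𝒜) : Prop where
  isSelfAdjoint : ∀ s, IsSelfAdjoint (a s)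
  sum_star_mul_self : ∑ s, star (a s) * a s = 1

lemma sum_star_mul_productKraus [Fintype S] [Fintype T] {r : T → 𝒜} {b : S → 𝒜}
    (hr : ∑ t, star (r t) * r t = 1) (hb : ∑ s, star (b s) * b s = 1) :
    ∑ p, star (productKraus r b p) * productKraus r b p = 1 := by
  have regroup (s : S) (t : T) : star (r t * b s) * (r t * b s) =
      star (b s) * (star (r t) * r t) * b s := by simp only [star_mul, mul_assoc]
  simp only [productKraus, Fintype.sum_prod_type, regroup, ← Finset.sum_mul, ← Finset.mul_sum,
    hr, mul_one, hb]

lemma sum_star_mul_sequentialKraus [Fintype S] {k : ℕ} {b : Fin k → S → 𝒜}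
    (hb : ∀ x, ∑ s, star (b x s) * b x s = 1) :
    ∑ f, star (sequentialKraus b f) * sequentialKraus b f = 1 := by
  induction k with
  | zero => simp [sequentialKraus]
  | succ k ih =>
    rw [← (Fin.consEquiv fun _ => S).sum_comp]
    exact sum_star_mul_productKraus (ih fun x => hb x.succ) (hb 0)

lemma commute_star_mul_self_of_isSelfAdjoint {x d : 𝒜} (hx : IsSelfAdjoint x)
    (h : Commute x d) : Commute x (star d * d) :=
  (hx.star_eq ▸ h.star_star).mul_right h

end Kraus

section PositiveFunctional

variable {𝒜 : Type*} [Ring 𝒜] [StarRing 𝒜] [Algebra ℝ 𝒜]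
variable {S T : Type*} [Fintype S] [Fintype T]

/-- Positivity of a real functional on a star algebra; the functionals of interest are the
unnormalized states `Z ↦ re ⟨v, Z v⟩` of `expectation`. -/
def IsPositiveFunctional (φ : 𝒜 →ₗ[ℝ] ℝ) : Prop := ∀ z, 0 ≤ φ (star z * z)

lemma IsPositiveFunctional.map_one_nonneg {φ : 𝒜 →ₗ[ℝ] ℝ} (hφ : IsPositiveFunctional φ) :
    0 ≤ φ 1 := by
  simpa only [star_one, mul_one] using hφ 1

lemma IsPositiveFunctional.abs_cross_le [StarModule ℝ 𝒜] {φ : 𝒜 →ₗ[ℝ] ℝ}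
    (hφ : IsPositiveFunctional φ) (x y : 𝒜) {c : ℝ} (hc : 0 < c) :
    |φ (star x * y + star y * x)| ≤ c⁻¹ * φ (star x * x) + c * φ (star y * y) := by
  have quadratic_nonneg (r : ℝ) :
      0 ≤ φ (star x * x) + r * φ (star x * y + star y * x) + r ^ 2 * φ (star y * y) := by
    have expand : star (x + r • y) * (x + r • y) =
        star x * x + r • (star x * y + star y * x) + r ^ 2 • (star y * y) := by
      simp only [star_add, star_smul, star_trivial, add_mul, mul_add, smul_mul_assoc,
        mul_smul_comm, smul_add, pow_two, mul_smul]
      abel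
    simpa only [expand, map_add, map_smul, smul_eq_mul] using hφ (x + r • y)
  have hplus := quadratic_nonneg c
  have hminus := quadratic_nonneg (-c)
  have hscale : c * (c⁻¹ * φ (star x * x) + c * φ (star y * y)) =
      φ (star x * x) + c ^ 2 * φ (star y * y) := by field_simp
  rw [abs_le]
  constructor <;> refine le_of_mul_le_mul_left ?_ hc <;> linarith

/-- The observable with value `w j` at the outcome `j` of the measurement with Kraus operators
`d j`. -/
def observable (w : S → ℝ) (d : S → 𝒜) : 𝒜 := ∑ j, w j • (star (d j) * d j)

lemma map_observable (φ : 𝒜 →ₗ[ℝ] ℝ) (w : S → ℝ) (d : S → 𝒜) :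
    φ (observable w d) = ∑ j, w j * φ (star (d j) * d j) := by
  simp only [observable, map_sum, map_smul, smul_eq_mul]

lemma star_mul_observable_mul (w : S → ℝ) (d : S → 𝒜) (x y : 𝒜) :
    star x * observable w d * y = ∑ j, w j • (star (d j * x) * (d j * y)) := by
  simp only [observable, Finset.mul_sum, Finset.sum_mul, mul_smul_comm, smul_mul_assoc, star_mul,
    mul_assoc]

lemma sum_map_star_mul_mul {d : S → 𝒜} (hd : ∑ j, star (d j) * d j = 1) (φ : 𝒜 →ₗ[ℝ] ℝ)
    (x : 𝒜) : ∑ j, φ (star (d j * x) * (d j * x)) = φ (star x * x) := by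
  have regroup (j : S) : star (d j * x) * (d j * x) = star x * (star (d j) * d j) * x := by
    simp only [star_mul, mul_assoc]
  simp only [regroup, ← map_sum, ← Finset.mul_sum, ← Finset.sum_mul, hd, mul_one]

lemma IsPositiveFunctional.abs_observable_cross_le [StarModule ℝ 𝒜] {φ : 𝒜 →ₗ[ℝ] ℝ}
    (hφ : IsPositiveFunctional φ) {w : S → ℝ} {d : S → 𝒜} (hw : ∀ j, |w j| ≤ 1)
    (hd : ∑ j, star (d j) * d j = 1) (x y : 𝒜) {c : ℝ} (hc : 0 < c) :
    |φ (star x * observable w d * y + star y * observable w d * x)| ≤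
      c⁻¹ * φ (star x * x) + c * φ (star y * y) := by
  simp only [star_mul_observable_mul, ← Finset.sum_add_distrib, ← smul_add, map_sum, map_smul,
    smul_eq_mul]
  calc |∑ j, w j * φ (star (d j * x) * (d j * y) + star (d j * y) * (d j * x))|
      ≤ ∑ j, |w j * φ (star (d j * x) * (d j * y) + star (d j * y) * (d j * x))| :=
        Finset.abs_sum_le_sum_abs _ _
    _ ≤ ∑ j, (c⁻¹ * φ (star (d j * x) * (d j * x)) + c * φ (star (d j * y) * (d j * y))) :=
        Finset.sum_le_sum fun j _ => by
          rw [abs_mul]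
          exact (mul_le_of_le_one_left (abs_nonneg _) (hw j)).trans (hφ.abs_cross_le _ _ hc)
    _ = c⁻¹ * φ (star x * x) + c * φ (star y * y) := by
        rw [Finset.sum_add_distrib, ← Finset.mul_sum, ← Finset.mul_sum,
          sum_map_star_mul_mul hd, sum_map_star_mul_mul hd]

/-- The squared distance, in the seminorm of the functional `φ`, between two families of Kraus
operators; it controls how differently the two measurements disturb `φ`. -/
def krausDistSq (φ : 𝒜 →ₗ[ℝ] ℝ) (a b : S → 𝒜) : ℝ :=
  ∑ s, φ (star (b s - a s) * (b s - a s))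

lemma krausDistSq_add_sum_eq (φ : 𝒜 →ₗ[ℝ] ℝ) {a b : S → 𝒜} (ha : ∑ s, star (a s) * a s = 1)
    (hb : ∑ s, star (b s) * b s = 1) :
    krausDistSq φ a b + ∑ s, φ (star (b s + a s) * (b s + a s)) = 4 * φ 1 := by
  have parallelogram (s : S) :
      star (b s - a s) * (b s - a s) + star (b s + a s) * (b s + a s) =
        (2 : ℝ) • (star (a s) * a s) + (2 : ℝ) • (star (b s) * b s) := by
    simp only [star_sub, star_add, sub_mul, mul_sub, add_mul, mul_add, two_smul]
    abel
  simp only [krausDistSq, ← map_sum, ← map_add, ← Finset.sum_add_distrib, parallelogram]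
  simp only [Finset.sum_add_distrib, ← Finset.smul_sum, ha, hb, map_add, map_smul, smul_eq_mul]
  ring

lemma IsPositiveFunctional.krausDistSq_nonneg {φ : 𝒜 →ₗ[ℝ] ℝ} (hφ : IsPositiveFunctional φ)
    (a b : S → 𝒜) : 0 ≤ krausDistSq φ a b :=
  Finset.sum_nonneg fun _ _ => hφ _

/-- An observable `D` commuting with the measurement `a` satisfies `D = ∑ s, a s⋆ * D * a s`, so
only the difference between `a` and `b` can change its value. -/
lemma IsPositiveFunctional.map_observable_le [StarModule ℝ 𝒜] {φ : 𝒜 →ₗ[ℝ] ℝ}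
    (hφ : IsPositiveFunctional φ) {a b : S → 𝒜} (ha : ∑ s, star (a s) * a s = 1)
    (hb : ∑ s, star (b s) * b s = 1) {w : T → ℝ} {d : T → 𝒜} (hw : ∀ j, |w j| ≤ 1)
    (hd : ∑ j, star (d j) * d j = 1) (hcomm : ∀ s, Commute (a s) (observable w d)) {c : ℝ}
    (hc : 0 < c) :
    φ (observable w d) ≤ φ (∑ s, star (b s) * observable w d * b s) +
      (krausDistSq φ a b / (2 * c) + 2 * c * φ 1) := by
  set D := observable w d
  have invariant : ∑ s, star (a s) * D * a s = D := by
    simp only [mul_assoc, ← (hcomm _).eq]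
    simp only [← mul_assoc, ← Finset.sum_mul, ha, one_mul]
  have polarize (s : S) :
      star (b s - a s) * D * (b s + a s) + star (b s + a s) * D * (b s - a s) =
        (2 : ℝ) • (star (b s) * D * b s - star (a s) * D * a s) := by
    simp only [star_sub, star_add, two_smul, sub_mul, mul_sub, add_mul, mul_add]
    abel
  have hdiff : ∑ s, φ (star (b s - a s) * D * (b s + a s) + star (b s + a s) * D * (b s - a s)) =
      2 * (φ (∑ s, star (b s) * D * b s) - φ D) := by
    simp only [polarize, map_smul, smul_eq_mul, ← Finset.mul_sum, map_sub,
      Finset.sum_sub_distrib, ← map_sum, invariant]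
  have hcross : |∑ s, φ (star (b s - a s) * D * (b s + a s) +
      star (b s + a s) * D * (b s - a s))| ≤ c⁻¹ * krausDistSq φ a b +
        c * ∑ s, φ (star (b s + a s) * (b s + a s)) := by
    rw [krausDistSq, Finset.mul_sum, Finset.mul_sum, ← Finset.sum_add_distrib]
    exact (Finset.abs_sum_le_sum_abs _ _).trans
      (Finset.sum_le_sum fun s _ => hφ.abs_observable_cross_le hw hd _ _ hc)
  have hsum : c * ∑ s, φ (star (b s + a s) * (b s + a s)) ≤ c * (4 * φ 1) :=
    mul_le_mul_of_nonneg_left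
      (by linarith [krausDistSq_add_sum_eq φ ha hb, hφ.krausDistSq_nonneg a b]) hc.le
  have hhalf : krausDistSq φ a b / (2 * c) = c⁻¹ * krausDistSq φ a b / 2 := by field_simp
  rw [hdiff] at hcross
  linarith [neg_le_of_abs_le hcross]

lemma commute_observable {w : S → ℝ} {d : S → 𝒜} {x : 𝒜}
    (h : ∀ j, Commute x (star (d j) * d j)) : Commute x (observable w d) :=
  Commute.sum_right _ _ _ fun j _ => (h j).smul_right _

lemma observable_productKraus (w : S × T → ℝ) (r : T → 𝒜) (b : S → 𝒜) :
    observable w (productKraus r b) =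
      ∑ s, star (b s) * observable (fun t => w (s, t)) r * b s := by
  simp only [star_mul_observable_mul]
  exact Fintype.sum_prod_type _

lemma observable_productKraus_sequentialKraus {k : ℕ} (w : (Fin (k + 1) → S) × T → ℝ)
    (r : T → 𝒜) (b : Fin (k + 1) → S → 𝒜) :
    observable w (productKraus r (sequentialKraus b)) = ∑ s, star (b 0 s) *
      observable (fun p => w (Fin.cons s p.1, p.2))
        (productKraus r (sequentialKraus (Fin.tail b))) * b 0 s := by
  simp only [star_mul_observable_mul]
  rw [observable, Fintype.sum_prod_type, ← (Fin.consEquiv fun _ => S).sum_comp,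
    Fintype.sum_prod_type]
  simp only [productKraus, Fintype.sum_prod_type, mul_assoc]
  rfl

/-- A measurement commuting with `r` can precede it undetected. -/
lemma observable_productKraus_of_commute (w : T → ℝ) {r : T → 𝒜} {b : S → 𝒜}
    (hb : ∑ s, star (b s) * b s = 1) (hbr : ∀ s t, Commute (b s) (star (r t) * r t)) :
    observable (fun p => w p.2) (productKraus r b) = observable w r := by
  rw [observable_productKraus]
  simp only [mul_assoc, ← (commute_observable (hbr _)).eq]
  simp only [← mul_assoc, ← Finset.sum_mul, hb, one_mul]

/-- Postponing the measurements of the other inputs is free, since they commute with `r`; moving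
each measurement of an earlier input out of the way costs one application of
`IsPositiveFunctional.map_observable_le`. -/
lemma IsPositiveFunctional.map_observable_le_sequentialKraus [StarModule ℝ 𝒜] {φ : 𝒜 →ₗ[ℝ] ℝ}
    (hφ : IsPositiveFunctional φ) {k : ℕ} {a b : Fin k → S → 𝒜} {r : T → 𝒜}
    (ha : ∀ x, IsLuders (a x)) (hb : ∀ x, ∑ s, star (b x s) * b x s = 1) (hr : IsLuders r)
    (hab : ∀ x s x' s', Commute (a x s) (b x' s')) (har : ∀ x s t, Commute (a x s) (r t))
    (hbr : ∀ x s t, Commute (b x s) (r t)) {w : S → T → ℝ} (hw : ∀ s t, |w s t| ≤ 1) {c : ℝ}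
    (hc : 0 < c) (x : Fin k) :
    φ (observable (fun p => w p.1 p.2) (productKraus r (b x))) ≤
      φ (observable (fun p => w (p.1 x) p.2) (productKraus r (sequentialKraus b))) +
        ∑ x', (krausDistSq φ (a x') (b x') / (2 * c) + 2 * c * φ 1) := by
  induction k with
  | zero => exact x.elim0
  | succ k ih =>
    have herr (x' : Fin (k + 1)) : 0 ≤ krausDistSq φ (a x') (b x') / (2 * c) + 2 * c * φ 1 :=
      add_nonneg (div_nonneg (hφ.krausDistSq_nonneg _ _) (by positivity))
        (mul_nonneg (by positivity) hφ.map_one_nonneg)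
    have htail := sum_star_mul_sequentialKraus (b := Fin.tail b) fun x => hb x.succ
    rw [observable_productKraus_sequentialKraus]
    cases x using Fin.cases with
    | zero =>
      have hcomm (f : Fin k → S) (t : T) :
          Commute (sequentialKraus (Fin.tail b) f) (star (r t) * r t) := by
        have h := (commute_sequentialKraus (fun i s => (hbr i.succ s t).symm) f).symm
        rw [(hr.isSelfAdjoint t).star_eq]
        exact h.mul_right h
      simp only [Fin.cons_zero, observable_productKraus_of_commute _ htail hcomm,
        observable_productKraus]
      exact le_add_of_nonneg_right (Finset.sum_nonneg fun x' _ => herr x')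
    | succ x =>
      have hcomm (s : S) (p : (Fin k → S) × T) :
          Commute (a 0 s) (productKraus r (sequentialKraus (Fin.tail b)) p) :=
        (har 0 s p.2).mul_right (commute_sequentialKraus (fun i => hab 0 s i.succ) p.1)
      have hpeel := hφ.map_observable_le (ha 0).sum_star_mul_self (hb 0)
        (w := fun p => w (p.1 x) p.2) (fun p => hw _ _)
        (sum_star_mul_productKraus hr.sum_star_mul_self htail)
        (fun s => commute_observable fun p =>
          commute_star_mul_self_of_isSelfAdjoint ((ha 0).isSelfAdjoint s) (hcomm s p)) hc
      have hrest := ih (a := Fin.tail a) (b := Fin.tail b) (fun x => ha x.succ)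
        (fun x => hb x.succ) (fun _ _ _ _ => hab _ _ _ _) (fun _ => har _) (fun _ => hbr _) x
      simp only [Fin.cons_succ]
      rw [Fin.sum_univ_succ]
      exact (hrest.trans (add_le_add_left hpeel _)).trans_eq (by simp only [Fin.tail]; ring)

/-- The probability that measuring `b` and then `a` gives two different outcomes, for the
unnormalized state `φ`. -/
def disagreement (φ : 𝒜 →ₗ[ℝ] ℝ) (a b : S → 𝒜) : ℝ :=
  φ 1 - ∑ s, φ (star (a s * b s) * (a s * b s))

lemma krausDistSq_le_two_mul_disagreement {φ : 𝒜 →ₗ[ℝ] ℝ} {a b : S → 𝒜} (ha : IsLuders a)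
    (hb : IsLuders b) (hab : ∀ s, Commute (a s) (b s))
    (h : ∑ s, φ (star (a s * b s) * (a s * b s)) ≤ ∑ s, φ (a s * b s)) :
    krausDistSq φ a b ≤ 2 * disagreement φ a b := by
  have expand (s : S) : star (b s - a s) * (b s - a s) =
      star (b s) * b s + star (a s) * a s - (2 : ℝ) • (a s * b s) := by
    simp only [star_sub, (ha.isSelfAdjoint s).star_eq, (hb.isSelfAdjoint s).star_eq, sub_mul,
      mul_sub, two_smul, ← (hab s).eq]
    abel
  have hdist : krausDistSq φ a b = 2 * φ 1 - 2 * ∑ s, φ (a s * b s) :=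
    calc krausDistSq φ a b
        = ∑ s, (φ (star (b s) * b s) + φ (star (a s) * a s) - 2 * φ (a s * b s)) := by
          simp only [krausDistSq, expand, map_sub, map_add, map_smul, smul_eq_mul]
      _ = 2 * φ 1 - 2 * ∑ s, φ (a s * b s) := by
          rw [Finset.sum_sub_distrib, Finset.sum_add_distrib, ← map_sum, ← map_sum,
            ha.sum_star_mul_self, hb.sum_star_mul_self, ← Finset.mul_sum]
          ring
  rw [hdist, disagreement]
  linarith

/-- The probability that measuring `b`, `r` and `a` gives the outcome `t` for `r` and the outcome
`s` for both `b` and `a`. -/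
def agreeProb (φ : 𝒜 →ₗ[ℝ] ℝ) (a b : S → 𝒜) (r : T → 𝒜) (s : S) (t : T) : ℝ :=
  φ (star (a s * productKraus r b (s, t)) * (a s * productKraus r b (s, t)))

lemma sum_agreeProb (φ : 𝒜 →ₗ[ℝ] ℝ) {a : S → 𝒜} (b : S → 𝒜) {r : T → 𝒜}
    (hr : ∑ t, star (r t) * r t = 1) (har : ∀ s t, Commute (a s) (r t)) :
    ∑ s, ∑ t, agreeProb φ a b r s t = φ 1 - disagreement φ a b := by
  have reorder (s : S) (t : T) : a s * productKraus r b (s, t) = r t * (a s * b s) := by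
    rw [productKraus, ← mul_assoc, (har s t).eq, mul_assoc]
  simp only [agreeProb, reorder, sum_map_star_mul_mul hr, disagreement, sub_sub_cancel]

lemma IsPositiveFunctional.sum_mul_agreeProb_le {φ : 𝒜 →ₗ[ℝ] ℝ} (hφ : IsPositiveFunctional φ)
    {a b : S → 𝒜} {r : T → 𝒜} (ha : ∑ s, star (a s) * a s = 1) (hb : ∑ s, star (b s) * b s = 1)
    (hr : ∑ t, star (r t) * r t = 1) (har : ∀ s t, Commute (a s) (r t)) {w : S → T → ℝ}
    (hw : ∀ s t, |w s t| ≤ 1) :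
    ∑ s, ∑ t, w s t * agreeProb φ a b r s t ≤
      φ (observable (fun p => w p.1 p.2) (productKraus r b)) + disagreement φ a b := by
  set q : S → T → ℝ := fun s t => φ (star (productKraus r b (s, t)) * productKraus r b (s, t))
  have hle (s : S) (t : T) : agreeProb φ a b r s t ≤ q s t :=
    (Finset.single_le_sum (f := fun s' => φ (star (a s' * productKraus r b (s, t)) *
      (a s' * productKraus r b (s, t)))) (fun _ _ => hφ _) (Finset.mem_univ s)).trans_eq
        (sum_map_star_mul_mul ha φ _)
  have hloss : disagreement φ a b = ∑ s, ∑ t, (q s t - agreeProb φ a b r s t) := by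
    have htotal : ∑ s, ∑ t, q s t = φ 1 := by
      rw [← Fintype.sum_prod_type', ← map_sum, sum_star_mul_productKraus hr hb]
    simp only [Finset.sum_sub_distrib, htotal, sum_agreeProb φ b hr har, sub_sub_cancel]
  rw [map_observable, Fintype.sum_prod_type, hloss]
  simp only [← Finset.sum_add_distrib]
  refine Finset.sum_le_sum fun s _ => Finset.sum_le_sum fun t _ => ?_
  have := mul_nonneg (neg_le_iff_add_nonneg.1 (abs_le.1 (hw s t)).1) (sub_nonneg.2 (hle s t))
  linarith

end PositiveFunctional

namespace BellGame

variable {n : ℕ} (G : BellGame n)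

lemma abs_score_le_one (x y s t : Fin n) : |G.score x y s t| ≤ 1 :=
  abs_le.2 (G.score_mem x y s t)

lemma sum_score_nonpos (f g : Fin n → Fin n) : ∑ x, ∑ y, G.score x y (f x) (g y) ≤ 0 := by
  obtain rfl | hn := n.eq_zero_or_pos
  · simp
  have h : classicalScore G.score f g ≤ 0 := G.classical_optimum.2 ⟨f, g, rfl⟩
  rwa [classicalScore, div_le_iff₀ (by positivity), zero_mul] at h

/-- If the second player's outcome distribution `κ f y` depends on the first player's answers `f`
to all inputs only through a weight `μ f`, then the two play a classical strategy. -/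
lemma sum_score_mul_nonpos {κ : (Fin n → Fin n) → Fin n → Fin n → ℝ} {μ : (Fin n → Fin n) → ℝ}
    (hκ : ∀ f y t, 0 ≤ κ f y t) (hμ : ∀ f y, ∑ t, κ f y t = μ f) :
    ∑ x, ∑ y, ∑ f, ∑ t, G.score x y (f x) t * κ f y t ≤ 0 := by
  obtain rfl | hn := n.eq_zero_or_pos
  · simp
  have : Nonempty (Fin n) := ⟨⟨0, hn⟩⟩
  have regroup : ∑ x, ∑ y, ∑ f, ∑ t, G.score x y (f x) t * κ f y t =
      ∑ f : Fin n → Fin n, ∑ y, ∑ t, (∑ x, G.score x y (f x) t) * κ f y t := by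
    rw [Finset.sum_comm_cycle]
    simp only [Finset.sum_mul]
    exact Finset.sum_congr rfl fun f _ => Finset.sum_comm_cycle.symm
  rw [regroup]
  refine Finset.sum_nonpos fun f _ => ?_
  choose g hg using fun y => Finite.exists_max fun t => ∑ x, G.score x y (f x) t
  have hμf : 0 ≤ μ f := hμ f ⟨0, hn⟩ ▸ Finset.sum_nonneg fun t _ => hκ f _ t
  calc ∑ y, ∑ t, (∑ x, G.score x y (f x) t) * κ f y t
      ≤ ∑ y, ∑ t, (∑ x, G.score x y (f x) (g y)) * κ f y t :=
        Finset.sum_le_sum fun y _ => Finset.sum_le_sum fun t _ =>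
          mul_le_mul_of_nonneg_right (hg y t) (hκ f y t)
    _ = (∑ x, ∑ y, G.score x y (f x) (g y)) * μ f := by
        simp only [← Finset.mul_sum, hμ]
        rw [← Finset.sum_mul, Finset.sum_comm]
    _ ≤ 0 := mul_nonpos_of_nonpos_of_nonneg (G.sum_score_nonpos f g) hμf

end BellGame

section OneRound

variable {𝒜 : Type*} [Ring 𝒜] [StarRing 𝒜] [Algebra ℝ 𝒜] {n : ℕ}

/-- Performing the measurements `b x` of all inputs one after the other is a classical strategy
of the first player. -/
lemma IsPositiveFunctional.sum_score_sequentialKraus_nonpos {φ : 𝒜 →ₗ[ℝ] ℝ}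
    (hφ : IsPositiveFunctional φ) (G : BellGame n) (b : Fin n → Fin n → 𝒜)
    {r : Fin n → Fin n → 𝒜} (hr : ∀ y, ∑ t, star (r y t) * r y t = 1) :
    ∑ x, ∑ y, φ (observable (fun p => G.score x y (p.1 x) p.2)
      (productKraus (r y) (sequentialKraus b))) ≤ 0 := by
  simp only [map_observable, Fintype.sum_prod_type]
  exact G.sum_score_mul_nonpos (fun f y t => hφ _)
    fun f y => sum_map_star_mul_mul (hr y) φ (sequentialKraus b f)

lemma IsPositiveFunctional.sum_score_mul_agreeProb_le [StarModule ℝ 𝒜] {φ : 𝒜 →ₗ[ℝ] ℝ}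
    (hφ : IsPositiveFunctional φ) (G : BellGame n) {a b r : Fin n → Fin n → 𝒜}
    (ha : ∀ x, IsLuders (a x)) (hb : ∀ x, ∑ s, star (b x s) * b x s = 1)
    (hr : ∀ y, IsLuders (r y)) (hab : ∀ x s x' s', Commute (a x s) (b x' s'))
    (har : ∀ x s y t, Commute (a x s) (r y t)) (hbr : ∀ x s y t, Commute (b x s) (r y t))
    (hdist : ∀ x, krausDistSq φ (a x) (b x) ≤ 2 * disagreement φ (a x) (b x)) {c : ℝ}
    (hc : 0 < c) :
    ∑ x, ∑ y, ∑ s, ∑ t, G.score x y s t * agreeProb φ (a x) (b x) (r y) s t ≤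
      n * ∑ x, disagreement φ (a x) (b x) +
        n ^ 2 * ((∑ x, disagreement φ (a x) (b x)) / c + n * (2 * c * φ 1)) := by
  set E := ∑ x, disagreement φ (a x) (b x)
  have herr : ∑ x, (krausDistSq φ (a x) (b x) / (2 * c) + 2 * c * φ 1) ≤
      E / c + n * (2 * c * φ 1) := by
    rw [Finset.sum_add_distrib, ← Finset.sum_div, Fin.sum_const, nsmul_eq_mul]
    have hsum : ∑ x, krausDistSq φ (a x) (b x) ≤ 2 * E := by
      rw [Finset.mul_sum]
      exact Finset.sum_le_sum fun x _ => hdist x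
    have hhalf : E / c = 2 * E / (2 * c) := by field_simp
    rw [hhalf]
    gcongr
  have hxy (x y : Fin n) :
      ∑ s, ∑ t, G.score x y s t * agreeProb φ (a x) (b x) (r y) s t ≤
        φ (observable (fun p => G.score x y (p.1 x) p.2)
          (productKraus (r y) (sequentialKraus b))) +
        (E / c + n * (2 * c * φ 1)) + disagreement φ (a x) (b x) := by
    have hagree := hφ.sum_mul_agreeProb_le (ha x).sum_star_mul_self (hb x)
      (hr y).sum_star_mul_self (fun s => har x s y) (G.abs_score_le_one x y)
    have hseq := hφ.map_observable_le_sequentialKraus ha hb (hr y) hab (fun x s => har x s y)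
      (fun x s => hbr x s y) (G.abs_score_le_one x y) hc x
    linarith
  refine (Finset.sum_le_sum fun x _ => Finset.sum_le_sum fun y _ => hxy x y).trans ?_
  have hclassical := hφ.sum_score_sequentialKraus_nonpos G b fun y => (hr y).sum_star_mul_self
  simp only [Finset.sum_add_distrib, Fin.sum_const, nsmul_eq_mul, ← Finset.mul_sum] at hclassical ⊢
  linarith

lemma exp_mul_sub_le {l δ s : ℝ} (hl : 0 ≤ l) (hl' : l ≤ 1 / 2) (hδ : |δ| ≤ 1) (hs : |s| ≤ 1) :
    Real.exp (l * (s - δ)) ≤ l * s + (1 - l * δ + 4 * l ^ 2) := by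
  have hz : |l * (s - δ)| ≤ 2 * l := by
    rw [abs_mul, abs_of_nonneg hl, mul_comm]
    exact mul_le_mul_of_nonneg_right ((abs_sub s δ).trans (by linarith)) hl
  have hexp := (abs_le.1 (Real.abs_exp_sub_one_sub_id_le (hz.trans (by linarith)))).2
  have hsq : (l * (s - δ)) ^ 2 ≤ (2 * l) ^ 2 := sq_le_sq' (abs_le.1 hz).1 (abs_le.1 hz).2
  linarith

/-- The value `l = δ / (16 n²)` and the scale `c = 2 n l` of
`IsPositiveFunctional.sum_score_mul_agreeProb_le` make the gain `l δ` beat all errors of order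
`l² n²`, while the coefficient of the disagreements stays negative. -/
lemma IsPositiveFunctional.sum_exp_mul_agreeProb_le [StarModule ℝ 𝒜] {φ : 𝒜 →ₗ[ℝ] ℝ}
    (hφ : IsPositiveFunctional φ) (hn : 0 < n) (G : BellGame n) {a b r : Fin n → Fin n → 𝒜}
    (ha : ∀ x, IsLuders (a x)) (hb : ∀ x, ∑ s, star (b x s) * b x s = 1)
    (hr : ∀ y, IsLuders (r y)) (hab : ∀ x s x' s', Commute (a x s) (b x' s'))
    (har : ∀ x s y t, Commute (a x s) (r y t)) (hbr : ∀ x s y t, Commute (b x s) (r y t))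
    (hdist : ∀ x, krausDistSq φ (a x) (b x) ≤ 2 * disagreement φ (a x) (b x)) {δ : ℝ}
    (hδ : 0 < δ) (hδ1 : δ ≤ 1) :
    ∑ x, ∑ y, ∑ s, ∑ t, Real.exp (δ / (16 * n ^ 2) * (G.score x y s t - δ)) *
      agreeProb φ (a x) (b x) (r y) s t ≤ n ^ 2 * φ 1 * (1 - δ ^ 2 / (32 * n ^ 2)) := by
  have hn1 : (1 : ℝ) ≤ n ^ 2 := one_le_pow₀ (by exact_mod_cast hn)
  set l : ℝ := δ / (16 * n ^ 2) with hl
  have hl0 : 0 < l := by positivity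
  have hl1 : l ≤ 1 / 16 := by
    rw [hl, div_le_div_iff₀ (by positivity) (by norm_num)]; nlinarith
  have hφ1 := hφ.map_one_nonneg
  set E := ∑ x, disagreement φ (a x) (b x)
  have hE : 0 ≤ E := Finset.sum_nonneg fun x _ => by
    linarith [hφ.krausDistSq_nonneg (a x) (b x), hdist x]
  have htotal : ∑ x, ∑ y, ∑ s, ∑ t, agreeProb φ (a x) (b x) (r y) s t =
      n ^ 2 * φ 1 - n * E := by
    simp only [sum_agreeProb φ _ (hr _).sum_star_mul_self fun s => har _ s _, Fin.sum_const,
      nsmul_eq_mul, ← Finset.mul_sum, Finset.sum_sub_distrib]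
    ring
  have hlδ : l * δ ≤ l := mul_le_of_le_one_right hl0.le hδ1
  calc _ ≤ ∑ x, ∑ y, ∑ s, ∑ t, (l * (G.score x y s t * agreeProb φ (a x) (b x) (r y) s t) +
        (1 - l * δ + 4 * l ^ 2) * agreeProb φ (a x) (b x) (r y) s t) := by
        gcongr with x _ y _ s _ t _
        rw [← mul_assoc, ← add_mul]
        exact mul_le_mul_of_nonneg_right (exp_mul_sub_le hl0.le (by linarith)
          (by rwa [abs_of_pos hδ]) (G.abs_score_le_one x y s t)) (hφ _)
    _ = l * (∑ x, ∑ y, ∑ s, ∑ t, G.score x y s t * agreeProb φ (a x) (b x) (r y) s t) +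
        (1 - l * δ + 4 * l ^ 2) * (n ^ 2 * φ 1 - n * E) := by
        rw [← htotal]; simp only [Finset.sum_add_distrib, Finset.mul_sum]
    _ ≤ l * (n * E + n ^ 2 * (E / (2 * n * l) + n * (2 * (2 * n * l) * φ 1))) +
        (1 - l * δ + 4 * l ^ 2) * (n ^ 2 * φ 1 - n * E) := by
        gcongr
        exact hφ.sum_score_mul_agreeProb_le G ha hb hr hab har hbr hdist (by positivity)
    _ = n ^ 2 * φ 1 * (1 - l * δ + 4 * l ^ 2 * (1 + n ^ 2)) -
        n * E * (1 / 2 - l * δ + 4 * l ^ 2 - l) := by field_simp; ring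
    _ ≤ n ^ 2 * φ 1 * (1 - l * δ + 4 * l ^ 2 * (n ^ 2 + n ^ 2)) - 0 := by
        gcongr
        exact mul_nonneg (by positivity) (by nlinarith)
    _ = n ^ 2 * φ 1 * (1 - δ ^ 2 / (32 * n ^ 2)) := by rw [hl]; field_simp; ring

end OneRound

section Matrices

variable {Q Q' : Type*}

lemma kronecker_sum {T : Type*} (s : Finset T) (M : Matrix Q Q ℂ) (f : T → Matrix Q' Q' ℂ) :
    M ⊗ₖ (∑ t ∈ s, f t) = ∑ t ∈ s, M ⊗ₖ f t :=
  map_sum (Matrix.kroneckerBilinear (R := ℂ) M) f s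

lemma sum_kronecker {T : Type*} (s : Finset T) (f : T → Matrix Q Q ℂ) (M : Matrix Q' Q' ℂ) :
    (∑ t ∈ s, f t) ⊗ₖ M = ∑ t ∈ s, f t ⊗ₖ M :=
  LinearMap.map_sum₂ (Matrix.kroneckerBilinear (R := ℂ)) s f M

variable [Fintype Q] [Fintype Q']

lemma commute_kronecker {a b : Matrix Q Q ℂ} {c d : Matrix Q' Q' ℂ} (hab : Commute a b)
    (hcd : Commute c d) : Commute (a ⊗ₖ c) (b ⊗ₖ d) := by
  rw [Commute, SemiconjBy, ← Matrix.mul_kronecker_mul, ← Matrix.mul_kronecker_mul, hab.eq, hcd.eq]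

/-- The expectation functional of the (not necessarily normalized) pure state `v`. -/
def expectation (v : Q → ℂ) : Matrix Q Q ℂ →ₗ[ℝ] ℝ where
  toFun Z := (star v ⬝ᵥ Z *ᵥ v).re
  map_add' := by simp [Matrix.add_mulVec, dotProduct_add]
  map_smul' := by simp [Matrix.smul_mulVec, dotProduct_smul]

lemma expectation_nonneg (v : Q → ℂ) {Z : Matrix Q Q ℂ} (hZ : Z.PosSemidef) :
    0 ≤ expectation v Z :=
  (Complex.le_def.1 (hZ.dotProduct_mulVec_nonneg v)).1

lemma expectation_mulVec (C : Matrix Q Q ℂ) (v : Q → ℂ) (Z : Matrix Q Q ℂ) :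
    expectation (C *ᵥ v) Z = expectation v (Cᴴ * Z * C) := by
  simp only [expectation, LinearMap.coe_mk, AddHom.coe_mk, Matrix.star_mulVec,
    Matrix.dotProduct_mulVec, Matrix.vecMul_vecMul]

variable [DecidableEq Q] [DecidableEq Q']

lemma isPositiveFunctional_expectation (v : Q → ℂ) : IsPositiveFunctional (expectation v) :=
  fun Z => expectation_nonneg v (Matrix.posSemidef_conjTranspose_mul_self Z)

lemma cfc_mul_cfc (f g : ℝ → ℝ) (M : Matrix Q Q ℂ) :
    cfc f M * cfc g M = cfc (fun x => f x * g x) M :=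
  (cfc_mul f g M (M.finite_real_spectrum.continuousOn f)
    (M.finite_real_spectrum.continuousOn g)).symm

open scoped MatrixOrder in
lemma cfc_congr_of_posSemidef {M : Matrix Q Q ℂ} (hM : M.PosSemidef) {f g : ℝ → ℝ}
    (h : ∀ x, 0 ≤ x → f x = g x) : cfc f M = cfc g M :=
  cfc_congr fun x hx =>
    h x (spectrum_nonneg_of_nonneg (Matrix.nonneg_iff_posSemidef.2 hM) hx)

lemma sqrt_mul_sqrt_self {M : Matrix Q Q ℂ} (hM : M.PosSemidef) :
    cfc Real.sqrt M * cfc Real.sqrt M = M := by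
  have hsa : IsSelfAdjoint M := hM.1
  conv_rhs => rw [← cfc_id' ℝ M]
  rw [cfc_mul_cfc]
  exact cfc_congr_of_posSemidef hM fun x hx => Real.mul_self_sqrt hx

open scoped MatrixOrder in
lemma posSemidef_sqrt_sub_self {M : Matrix Q Q ℂ} (hM : M.PosSemidef)
    (hM1 : (1 - M).PosSemidef) : (cfc Real.sqrt M - M).PosSemidef := by
  have hsa : IsSelfAdjoint M := hM.1
  have hle_sqrt : cfc (fun x : ℝ => x) M ≤ cfc Real.sqrt M := cfc_mono fun x hx => by
    have hx0 : 0 ≤ x := spectrum_nonneg_of_nonneg (Matrix.nonneg_iff_posSemidef.2 hM) hx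
    have hx1 : x ≤ 1 := (CFC.le_one_iff (R := ℝ) M hsa).1 (Matrix.le_iff.2 hM1) x hx
    exact Real.le_sqrt_of_sq_le (by nlinarith)
  rw [cfc_id' ℝ M] at hle_sqrt
  exact Matrix.le_iff.1 hle_sqrt

section Measurement

variable {S : Type*} [Fintype S]

lemma IsMeasurement.one_sub_posSemidef {P : S → Matrix Q Q ℂ} (hP : IsMeasurement P) (s : S) :
    (1 - P s).PosSemidef := by
  classical
  rw [← hP.sum_eq_one, ← Finset.sum_erase_eq_sub (Finset.mem_univ s)]
  exact Matrix.posSemidef_sum _ fun s' _ => hP.posSemidef s'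

lemma IsMeasurement.isLuders_sqrt {P : S → Matrix Q Q ℂ} (hP : IsMeasurement P) :
    IsLuders fun s => cfc Real.sqrt (P s) where
  isSelfAdjoint _ := IsSelfAdjoint.cfc
  sum_star_mul_self := by
    simp only [IsSelfAdjoint.cfc.star_eq, sqrt_mul_sqrt_self (hP.posSemidef _), hP.sum_eq_one]

lemma IsMeasurement.posSemidef_sqrt_sub_mul_self {P : S → Matrix Q Q ℂ} (hP : IsMeasurement P)
    (s : S) : (cfc Real.sqrt (P s) - cfc Real.sqrt (P s) * cfc Real.sqrt (P s)).PosSemidef := by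
  rw [sqrt_mul_sqrt_self (hP.posSemidef s)]
  exact posSemidef_sqrt_sub_self (hP.posSemidef s) (hP.one_sub_posSemidef s)

lemma IsLuders.kronecker_one {a : S → Matrix Q Q ℂ} (ha : IsLuders a) :
    IsLuders fun s => a s ⊗ₖ (1 : Matrix Q' Q' ℂ) where
  isSelfAdjoint s := by
    rw [isSelfAdjoint_iff, Matrix.star_eq_conjTranspose, Matrix.conjTranspose_kronecker,
      Matrix.conjTranspose_one, ← Matrix.star_eq_conjTranspose, (ha.isSelfAdjoint s).star_eq]
  sum_star_mul_self := by
    simp only [Matrix.star_eq_conjTranspose, Matrix.conjTranspose_kronecker,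
      Matrix.conjTranspose_one, ← Matrix.mul_kronecker_mul, mul_one, ← sum_kronecker]
    simp only [← Matrix.star_eq_conjTranspose, ha.sum_star_mul_self, Matrix.one_kronecker_one]

lemma IsLuders.one_kronecker {a : S → Matrix Q' Q' ℂ} (ha : IsLuders a) :
    IsLuders fun s => (1 : Matrix Q Q ℂ) ⊗ₖ a s where
  isSelfAdjoint s := by
    rw [isSelfAdjoint_iff, Matrix.star_eq_conjTranspose, Matrix.conjTranspose_kronecker,
      Matrix.conjTranspose_one, ← Matrix.star_eq_conjTranspose, (ha.isSelfAdjoint s).star_eq]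
  sum_star_mul_self := by
    simp only [Matrix.star_eq_conjTranspose, Matrix.conjTranspose_kronecker,
      Matrix.conjTranspose_one, ← Matrix.mul_kronecker_mul, mul_one, ← kronecker_sum]
    simp only [← Matrix.star_eq_conjTranspose, ha.sum_star_mul_self, Matrix.one_kronecker_one]

lemma IsLuders.posSemidef_mul_self {a : S → Matrix Q Q ℂ} (ha : IsLuders a) (s : S) :
    (a s * a s).PosSemidef := by
  have h := Matrix.posSemidef_conjTranspose_mul_self (a s)
  rwa [← Matrix.star_eq_conjTranspose, (ha.isSelfAdjoint s).star_eq] at h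

omit [DecidableEq Q] in
lemma posSemidef_kronecker_one_sub_mul_self {M : Matrix Q Q ℂ} (h : (M - M * M).PosSemidef) :
    (M ⊗ₖ (1 : Matrix Q' Q' ℂ) -
      (M ⊗ₖ (1 : Matrix Q' Q' ℂ)) * (M ⊗ₖ (1 : Matrix Q' Q' ℂ))).PosSemidef := by
  have hsub := LinearMap.map_sub₂ (Matrix.kroneckerBilinear (R := ℂ)) M (M * M)
    (1 : Matrix Q' Q' ℂ)
  rw [← Matrix.mul_kronecker_mul, mul_one]
  exact hsub ▸ h.kronecker .one

/-- The operator inequality `a² ⊗ b² ≤ a ⊗ b` turns the overlap of the Kraus operators into the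
probability of agreement. -/
lemma krausDistSq_kronecker_le {a : S → Matrix Q Q ℂ} {b : S → Matrix Q' Q' ℂ}
    (ha : IsLuders a) (hb : IsLuders b) (ha' : ∀ s, (a s - a s * a s).PosSemidef)
    (hb' : ∀ s, (b s - b s * b s).PosSemidef) (v : Q × Q' → ℂ) :
    krausDistSq (expectation v) (fun s => a s ⊗ₖ (1 : Matrix Q' Q' ℂ))
        (fun s => (1 : Matrix Q Q ℂ) ⊗ₖ b s) ≤
      2 * disagreement (expectation v) (fun s => a s ⊗ₖ (1 : Matrix Q' Q' ℂ))
        (fun s => (1 : Matrix Q Q ℂ) ⊗ₖ b s) := by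
  refine krausDistSq_le_two_mul_disagreement ha.kronecker_one hb.one_kronecker
    (fun s => commute_kronecker (.one_right _) (.one_left _)) (Finset.sum_le_sum fun s _ => ?_)
  have hb0 : (b s).PosSemidef := by
    simpa only [sub_add_cancel] using (hb' s).add (hb.posSemidef_mul_self s)
  have hsplit : a s ⊗ₖ b s - (a s * a s) ⊗ₖ (b s * b s) =
      (a s - a s * a s) ⊗ₖ b s + (a s * a s) ⊗ₖ (b s - b s * b s) := by
    ext i j
    simp only [Matrix.sub_apply, Matrix.add_apply, Matrix.kroneckerMap_apply]
    ring
  have hpos : (a s ⊗ₖ b s - (a s * a s) ⊗ₖ (b s * b s)).PosSemidef := hsplit ▸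
    ((ha' s).kronecker hb0).add ((ha.posSemidef_mul_self s).kronecker (hb' s))
  simp only [← Matrix.mul_kronecker_mul, mul_one, one_mul, Matrix.star_eq_conjTranspose,
    Matrix.conjTranspose_kronecker]
  simp only [← Matrix.star_eq_conjTranspose, (ha.isSelfAdjoint s).star_eq,
    (hb.isSelfAdjoint s).star_eq]
  exact sub_nonneg.1 ((expectation_nonneg v hpos).trans_eq (map_sub _ _ _))

end Measurement

end Matrices

section LocalRound

variable {n : ℕ} {A B A' B' : Type*} [Fintype A] [DecidableEq A] [Fintype B] [DecidableEq B]
  [Fintype A'] [DecidableEq A'] [Fintype B'] [DecidableEq B']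

lemma agreeProb_sqrt_kronecker {S T : Type*} [Fintype S] [Fintype T] (v : (A × B) × (A' × B') → ℂ)
    {P : S → Matrix A A ℂ} {P' : S → Matrix A' A' ℂ} {R : T → Matrix B B ℂ}
    {R' : T → Matrix B' B' ℂ} (hP : IsMeasurement P) (hP' : IsMeasurement P')
    (hR : IsMeasurement R) (hR' : IsMeasurement R') (s : S) (t : T) :
    agreeProb (expectation v)
        (fun s => (cfc Real.sqrt (P s) ⊗ₖ (1 : Matrix B B ℂ)) ⊗ₖ (1 : Matrix (A' × B') (A' × B') ℂ))
        (fun s => (1 : Matrix (A × B) (A × B) ℂ) ⊗ₖ (cfc Real.sqrt (P' s) ⊗ₖ (1 : Matrix B' B' ℂ)))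
        (fun t => ((1 : Matrix A A ℂ) ⊗ₖ cfc Real.sqrt (R t)) ⊗ₖ
          (1 : Matrix (A' × B') (A' × B') ℂ)) s t =
      ∑ t', expectation v ((P s ⊗ₖ R t) ⊗ₖ (P' s ⊗ₖ R' t')) := by
  rw [← map_sum, ← kronecker_sum, ← kronecker_sum, hR'.sum_eq_one, agreeProb, productKraus]
  simp only [← Matrix.mul_kronecker_mul, mul_one, one_mul, Matrix.star_eq_conjTranspose,
    Matrix.conjTranspose_kronecker, Matrix.conjTranspose_one]
  simp only [← Matrix.star_eq_conjTranspose, IsSelfAdjoint.cfc.star_eq,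
    sqrt_mul_sqrt_self (hP.posSemidef s), sqrt_mul_sqrt_self (hP'.posSemidef s),
    sqrt_mul_sqrt_self (hR.posSemidef t)]

lemma sum_exp_mul_expectation_kronecker_le (hn : 0 < n) (G : BellGame n)
    {P : Fin n → Fin n → Matrix A A ℂ} {R : Fin n → Fin n → Matrix B B ℂ}
    {P' : Fin n → Fin n → Matrix A' A' ℂ} {R' : Fin n → Fin n → Matrix B' B' ℂ}
    (hP : ∀ x, IsMeasurement (P x)) (hR : ∀ y, IsMeasurement (R y))
    (hP' : ∀ x, IsMeasurement (P' x)) (hR' : ∀ y, IsMeasurement (R' y))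
    (v : (A × B) × (A' × B') → ℂ) {δ : ℝ} (hδ : 0 < δ) (hδ1 : δ ≤ 1) :
    ∑ x, ∑ y, ∑ s, ∑ t, Real.exp (δ / (16 * n ^ 2) * (G.score x y s t - δ)) *
      ∑ t', expectation v ((P x s ⊗ₖ R y t) ⊗ₖ (P' x s ⊗ₖ R' y t')) ≤
      n ^ 2 * expectation v 1 * (1 - δ ^ 2 / (32 * n ^ 2)) := by
  simp only [← agreeProb_sqrt_kronecker v (hP _) (hP' _) (hR _) (hR' _)]
  refine (isPositiveFunctional_expectation v).sum_exp_mul_agreeProb_le hn G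
    (fun x => (hP x).isLuders_sqrt.kronecker_one.kronecker_one)
    (fun x => (hP' x).isLuders_sqrt.kronecker_one.one_kronecker.sum_star_mul_self)
    (fun y => (hR y).isLuders_sqrt.one_kronecker.kronecker_one)
    (fun x s x' s' => commute_kronecker (.one_right _) (.one_left _))
    (fun x s y t => commute_kronecker
      (commute_kronecker (.one_right _) (.one_left _)) (.one_left _))
    (fun x s y t => commute_kronecker (.one_left _) (.one_right _)) (fun x => ?_) hδ hδ1
  exact krausDistSq_kronecker_le (hP x).isLuders_sqrt.kronecker_one
    (hP' x).isLuders_sqrt.kronecker_one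
    (fun s => posSemidef_kronecker_one_sub_mul_self ((hP x).posSemidef_sqrt_sub_mul_self s))
    (fun s => posSemidef_kronecker_one_sub_mul_self ((hP' x).posSemidef_sqrt_sub_mul_self s)) v

end LocalRound

section Support

variable {Q : Type*} [Fintype Q] [DecidableEq Q] {M M' : Matrix Q Q ℂ}

lemma supportProj_mul_self (hM : M.PosSemidef) : supportProj M * M = M := by
  have hsa : IsSelfAdjoint M := hM.1
  nth_rw 2 3 [← cfc_id' ℝ M]
  rw [supportProj, cfc_mul_cfc]
  exact cfc_congr_of_posSemidef hM fun x _ => by by_cases hx : x = 0 <;> simp [hx]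

lemma sqrt_mul_invSqrt (hM : M.PosSemidef) : cfc Real.sqrt M * invSqrt M = supportProj M := by
  rw [invSqrt, supportProj, cfc_mul_cfc]
  refine cfc_congr_of_posSemidef hM fun x hx => ?_
  rcases hx.eq_or_lt with rfl | hx
  · simp
  · simp [hx.ne', mul_inv_cancel₀ (Real.sqrt_pos.2 hx).ne']

lemma invSqrt_mul_sqrt (hM : M.PosSemidef) : invSqrt M * cfc Real.sqrt M = supportProj M := by
  rw [← sqrt_mul_invSqrt hM, invSqrt, cfc_mul_cfc, cfc_mul_cfc]
  simp only [mul_comm]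

lemma sqrt_mul_supportProj (hM : M.PosSemidef) :
    cfc Real.sqrt M * supportProj M = cfc Real.sqrt M := by
  rw [supportProj, cfc_mul_cfc]
  exact cfc_congr_of_posSemidef hM fun x _ => by by_cases hx : x = 0 <;> simp [hx]

lemma supportProj_mul_sqrt (hM : M.PosSemidef) :
    supportProj M * cfc Real.sqrt M = cfc Real.sqrt M := by
  rw [supportProj, cfc_mul_cfc]
  exact cfc_congr_of_posSemidef hM fun x _ => by by_cases hx : x = 0 <;> simp [hx]

lemma isHermitian_supportProj (M : Matrix Q Q ℂ) : (supportProj M).IsHermitian :=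
  IsSelfAdjoint.cfc

open scoped MatrixOrder in
omit [DecidableEq Q] in
lemma mul_eq_zero_of_conjTranspose_mul_mul_eq_zero (hM : M.PosSemidef) {C : Matrix Q Q ℂ}
    (h : Cᴴ * M * C = 0) : M * C = 0 := by
  classical
  obtain ⟨K, rfl⟩ := CStarAlgebra.nonneg_iff_eq_star_mul_self.1 hM.nonneg
  have hKC : K * C = 0 := by
    rw [← Matrix.conjTranspose_mul_self_eq_zero, Matrix.conjTranspose_mul, ← h,
      Matrix.star_eq_conjTranspose]
    simp only [mul_assoc]
  rw [mul_assoc, hKC, mul_zero]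

open scoped MatrixOrder in
lemma mul_supportProj_of_le (hM : M.PosSemidef) (hM' : M'.PosSemidef)
    (hle : (M - M').PosSemidef) : M' * supportProj M = M' := by
  have hherm : (1 - supportProj M)ᴴ = 1 - supportProj M := by
    rw [Matrix.conjTranspose_sub, Matrix.conjTranspose_one, (isHermitian_supportProj M).eq]
  have hkill : (1 - supportProj M) * M = 0 := by
    rw [sub_mul, one_mul, supportProj_mul_self hM, sub_self]
  have hneg := hle.conjTranspose_mul_mul_same (1 - supportProj M)
  rw [mul_sub (1 - supportProj M)ᴴ, hherm, hkill, zero_sub, neg_mul] at hneg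
  have hpos := hM'.conjTranspose_mul_mul_same (1 - supportProj M)
  have hzero : (1 - supportProj M)ᴴ * M' * (1 - supportProj M) = 0 := by
    refine le_antisymm (neg_nonneg.1 ?_) hpos.nonneg
    rw [hherm]
    exact hneg.nonneg
  have hM'C := mul_eq_zero_of_conjTranspose_mul_mul_eq_zero hM' hzero
  rw [mul_sub, mul_one, sub_eq_zero] at hM'C
  exact hM'C.symm

lemma supportProj_mul_of_le (hM : M.PosSemidef) (hM' : M'.PosSemidef)
    (hle : (M - M').PosSemidef) : supportProj M * M' = M' := by
  have h := congrArg Matrix.conjTranspose (mul_supportProj_of_le hM hM' hle)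
  rwa [Matrix.conjTranspose_mul, hM'.1.eq, (isHermitian_supportProj M).eq] at h

end Support

section Marginals

variable {Q U T : Type*} [Fintype T] [DecidableEq T] {N : ℕ}
  {F : (Fin N → U) → (Fin N → T) → Matrix Q Q ℂ}

lemma marginal_all (u : Fin N → U) (t : Fin N → T) : marginal F N u t = F u t := by
  have hagree : (Finset.univ.filter fun t' : Fin N → T =>
      ∀ j : Fin N, (j : ℕ) < N → t' j = t j) = {t} := by
    ext t'
    simp [funext_iff]
  rw [marginal, hagree, Finset.sum_singleton]

omit [Fintype T] [DecidableEq T] in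
lemma eq_update_below_succ_iff (i : Fin N) (t t' : Fin N → T) (w : T) :
    (∀ j : Fin N, (j : ℕ) < i + 1 → t' j = Function.update t i w j) ↔
      t' i = w ∧ ∀ j : Fin N, (j : ℕ) < i → t' j = t j := by
  constructor
  · refine fun h => ⟨by simpa using h i (Nat.lt_succ_self _), fun j hj => ?_⟩
    rw [h j (Nat.lt_succ_of_lt hj), Function.update_of_ne (Fin.ne_of_lt hj)]
  · rintro ⟨rfl, h⟩ j hj
    rcases Nat.lt_succ_iff_lt_or_eq.1 hj with hj | hj
    · rw [Function.update_of_ne (Fin.ne_of_lt hj), h j hj]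
    · rw [Fin.ext hj, Function.update_self]

lemma sum_marginal_update (i : Fin N) (u : Fin N → U) (t : Fin N → T) :
    ∑ w, marginal F (i + 1) u (Function.update t i w) = marginal F i u t := by
  simp only [marginal, Finset.sum_filter, eq_update_below_succ_iff, ite_and]
  rw [Finset.sum_comm]
  simp only [Finset.sum_ite_eq, Finset.mem_univ, if_true]

lemma marginal_map_conj (F : (Fin N → U) → (Fin N → T) → Matrix Q Q ℂ) (i : ℕ) (u : Fin N → U)
    (t : Fin N → T) : marginal (fun u t => (F u t).map (starRingEnd ℂ)) i u t =
      (marginal F i u t).map (starRingEnd ℂ) :=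
  (map_sum (starRingEnd ℂ).toAddMonoidHom.mapMatrix _ _).symm

variable [Fintype Q] [DecidableEq Q]

lemma IsSequential.posSemidef_marginal (hF : IsSequential F) (i : ℕ) (u : Fin N → U)
    (t : Fin N → T) : (marginal F i u t).PosSemidef :=
  Matrix.posSemidef_sum _ fun t' _ => (hF.isMeasurement u).posSemidef t'

lemma IsSequential.marginal_zero (hF : IsSequential F) (u : Fin N → U) (t : Fin N → T) :
    marginal F 0 u t = 1 := by
  simp [marginal, (hF.isMeasurement u).sum_eq_one]

lemma IsSequential.posSemidef_marginal_sub_marginal (hF : IsSequential F) (i : Fin N)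
    (u : Fin N → U) (t : Fin N → T) (v : U) (w : T) :
    (marginal F i u t -
      marginal F (i + 1) (Function.update u i v) (Function.update t i w)).PosSemidef := by
  have hpast : marginal F i u t = marginal F i (Function.update u i v) t :=
    hF.nonanticipating i _ _ (fun j hj => by rw [Function.update_of_ne (Fin.ne_of_lt hj)]) t
  rw [hpast, ← sum_marginal_update, ← Finset.sum_erase_eq_sub (Finset.mem_univ w)]
  exact Matrix.posSemidef_sum _ fun w' _ => hF.posSemidef_marginal _ _ _

lemma IsSequential.marginal_succ_eq (hF : IsSequential F) (i : Fin N) (u : Fin N → U)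
    (t : Fin N → T) (v : U) (w : T) :
    marginal F (i + 1) (Function.update u i v) (Function.update t i w) =
      cfc Real.sqrt (marginal F i u t) * conditional F i u t v w *
        cfc Real.sqrt (marginal F i u t) := by
  have hM := hF.posSemidef_marginal i u t
  have hM' := hF.posSemidef_marginal (i + 1) (Function.update u i v) (Function.update t i w)
  have hle := hF.posSemidef_marginal_sub_marginal i u t v w
  rw [conditional, mul_assoc, mul_assoc, mul_assoc, invSqrt_mul_sqrt hM, ← mul_assoc,
    sqrt_mul_invSqrt hM, mul_supportProj_of_le hM hM' hle, supportProj_mul_of_le hM hM' hle]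

end Marginals

section LocalRounds

variable {n N : ℕ} {A B : Type*} [Fintype A] [DecidableEq A] [Fintype B] [DecidableEq B]
  {F : Pairs n N → Pairs n N → Matrix (A × B) (A × B) ℂ}

/-- Every round of the strategy `F` on `AB` consists of independent measurements of `A` and `B`:
the operator `M` of a history factors as `M = Kᴴ K`, and the next round extends it to
`Kᴴ (P x s ⊗ R y t) K`.  In contrast to conditional strategies, this notion involves neither
inverses nor supports, and it is invariant under complex conjugation. -/
def HasLocalRounds (F : Pairs n N → Pairs n N → Matrix (A × B) (A × B) ℂ) : Prop :=
  ∀ (i : Fin N) (u t : Pairs n N), ∃ (K : Matrix (A × B) (A × B) ℂ)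
    (P : Fin n → Fin n → Matrix A A ℂ) (R : Fin n → Fin n → Matrix B B ℂ),
    Kᴴ * K = marginal F i u t ∧ (∀ x, IsMeasurement (P x)) ∧ (∀ y, IsMeasurement (R y)) ∧
    ∀ x y s t', marginal F (i + 1) (Function.update u i (x, y)) (Function.update t i (s, t')) =
      Kᴴ * (P x s ⊗ₖ R y t') * K

lemma isMeasurement_single {Q T : Type*} [Fintype Q] [DecidableEq Q] [Fintype T]
    [DecidableEq T] (t₀ : T) : IsMeasurement (Pi.single t₀ (1 : Matrix Q Q ℂ)) where
  posSemidef t := by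
    rw [Pi.single_apply]
    split_ifs
    exacts [.one, .zero]
  sum_eq_one := by simp

lemma IsBipartiteSequential.hasLocalRounds (hF : IsBipartiteSequential F) :
    HasLocalRounds F := by
  intro i u t
  have hM := hF.isSequential.posSemidef_marginal i u t
  have hsqrt : (cfc Real.sqrt (marginal F i u t))ᴴ = cfc Real.sqrt (marginal F i u t) :=
    IsSelfAdjoint.cfc
  have hsq : (cfc Real.sqrt (marginal F i u t))ᴴ * cfc Real.sqrt (marginal F i u t) =
      marginal F i u t := hsqrt.symm ▸ sqrt_mul_sqrt_self hM
  by_cases hzero : marginal F i u t = 0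
  · refine ⟨_, fun _ => Pi.single (u i).1 1, fun _ => Pi.single (u i).1 1, hsq,
      fun _ => isMeasurement_single _, fun _ => isMeasurement_single _, fun x y s t' => ?_⟩
    simp only [hF.isSequential.marginal_succ_eq, hzero, cfc_apply_zero, Real.sqrt_zero, map_zero,
      mul_zero]
  · obtain ⟨P, R, hP, hR, hcond⟩ := hF.bipartite i u t hzero
    refine ⟨_, P, R, hsq, hP, hR, fun x y s t' => ?_⟩
    rw [hsqrt, hF.isSequential.marginal_succ_eq, hcond, ← mul_assoc, ← mul_assoc,
      sqrt_mul_supportProj hM, mul_assoc _ (supportProj _), supportProj_mul_sqrt hM]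

lemma posSemidef_map_conj {Q : Type*} {M : Matrix Q Q ℂ} (hM : M.PosSemidef) :
    (M.map (starRingEnd ℂ)).PosSemidef := by
  have hconj : M.map (starRingEnd ℂ) = Mᵀ := congrArg Matrix.transpose hM.1
  exact hconj ▸ hM.transpose

lemma IsMeasurement.map_conj {Q T : Type*} [Fintype Q] [DecidableEq Q] [Fintype T]
    {P : T → Matrix Q Q ℂ} (hP : IsMeasurement P) :
    IsMeasurement fun t => (P t).map (starRingEnd ℂ) where
  posSemidef t := posSemidef_map_conj (hP.posSemidef t)
  sum_eq_one := by
    have hsum := map_sum (starRingEnd ℂ).mapMatrix P Finset.univ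
    rw [hP.sum_eq_one, map_one] at hsum
    exact hsum.symm

lemma HasLocalRounds.map_conj (hF : HasLocalRounds F) :
    HasLocalRounds fun u t => (F u t).map (starRingEnd ℂ) := by
  intro i u t
  obtain ⟨K, P, R, hK, hP, hR, hsucc⟩ := hF i u t
  refine ⟨K.map (starRingEnd ℂ), fun x s => (P x s).map (starRingEnd ℂ),
    fun y t => (R y t).map (starRingEnd ℂ), ?_, fun x => (hP x).map_conj, fun y => (hR y).map_conj,
    fun x y s t' => ?_⟩
  · rw [marginal_map_conj, ← hK, Matrix.map_mul]
    rfl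
  · rw [marginal_map_conj, hsucc, Matrix.map_mul, Matrix.map_mul, Matrix.kroneckerMap_map,
      Matrix.kroneckerMap_map_left, Matrix.kroneckerMap_map_right]
    simp only [map_mul]
    rfl

end LocalRounds

lemma sum_prod_mul_le_pow_mul {α : Type*} [Fintype α] {N : ℕ} {c : α → ℝ} (hc : ∀ a, 0 ≤ c a)
    {κ : ℝ} (hκ : 0 ≤ κ) {H : ℕ → (Fin N → α) → ℝ}
    (hstep : ∀ (i : Fin N) (z : Fin N → α),
      ∑ a, c a * H (i + 1) (Function.update z i a) ≤ κ * H i z) (d : Fin N → α) :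
    ∑ z, (∏ j, c (z j)) * H N z ≤ κ ^ N * H 0 d := by
  induction N with
  | zero => simp [Subsingleton.elim (default : Fin 0 → α) d]
  | succ N ih =>
    have hrest (a : α) : ∑ z : Fin N → α, (∏ j, c (z j)) * H (N + 1) (Fin.cons a z) ≤
        κ ^ N * H 1 (Fin.cons a (Fin.tail d)) :=
      ih (H := fun i z => H (i + 1) (Fin.cons a z))
        (fun i z => by
          simpa only [Fin.cons_update, Fin.val_succ] using hstep i.succ (Fin.cons a z))
        (Fin.tail d)
    have hupdate (a : α) : Function.update d 0 a = Fin.cons a (Fin.tail d) := by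
      rw [← Fin.update_cons_zero (α := fun _ => α) (d 0), Fin.cons_self_tail]
    have hfirst : ∑ a, c a * H 1 (Fin.cons a (Fin.tail d)) ≤ κ * H 0 d := by
      simpa only [Fin.val_zero, zero_add, hupdate] using hstep 0 d
    calc ∑ z, (∏ j, c (z j)) * H (N + 1) z
        = ∑ a, c a * ∑ z : Fin N → α, (∏ j, c (z j)) * H (N + 1) (Fin.cons a z) := by
          rw [← (Fin.consEquiv fun _ => α).sum_comp, Fintype.sum_prod_type]
          simp only [Fin.prod_univ_succ, Finset.mul_sum, mul_assoc]
          rfl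
      _ ≤ ∑ a, c a * (κ ^ N * H 1 (Fin.cons a (Fin.tail d))) :=
          Finset.sum_le_sum fun a _ => mul_le_mul_of_nonneg_left (hrest a) (hc a)
      _ = κ ^ N * ∑ a, c a * H 1 (Fin.cons a (Fin.tail d)) := by
          simp only [Finset.mul_sum, mul_left_comm]
      _ ≤ κ ^ N * (κ * H 0 d) := mul_le_mul_of_nonneg_left hfirst (pow_nonneg hκ N)
      _ = κ ^ (N + 1) * H 0 d := by rw [pow_succ, mul_assoc]

lemma div_sq_le_one {n : ℕ} (hn : 0 < n) {δ : ℝ} (hδ : 0 ≤ δ) (hδ1 : δ ≤ 1) :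
    δ ^ 2 / (32 * (n : ℝ) ^ 2) ≤ 1 := by
  have hn1 : (1 : ℝ) ≤ n := by exact_mod_cast hn
  rw [div_le_one (by positivity)]
  nlinarith

section Histories

variable {n N : ℕ}

/-- The transcript of one round in which the two parties receive the same inputs: these inputs,
the outputs of the devices and the outputs of the adversary. -/
abbrev Round (n : ℕ) := (Fin n × Fin n) × (Fin n × Fin n) × (Fin n × Fin n)

/-- The factor contributed by a round to the exponential moment, with parameter `l`, of the score
of the devices on the event that Alice's outputs agree; it includes the probability `n⁻²` of the
inputs. -/
def roundFactor (G : BellGame n) (l δ : ℝ) (a : Round n) : ℝ :=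
  ((n : ℝ) ^ 2)⁻¹ * if a.2.1.1 = a.2.2.1 then
    Real.exp (l * (G.score a.1.1 a.1.2 a.2.1.1 a.2.1.2 - δ)) else 0

lemma roundFactor_nonneg (G : BellGame n) (l δ : ℝ) (a : Round n) :
    0 ≤ roundFactor G l δ a := by
  rw [roundFactor]
  split_ifs <;> positivity

/-- The weight of the first `i` rounds of the history `z` when the strategies `F` and `F'` are
performed on the two parts of the pure state `v`, without the probability of the inputs. -/
def historyWeight {Q Q' : Type*} [Fintype Q] [Fintype Q'] (v : Q × Q' → ℂ)
    (F : Pairs n N → Pairs n N → Matrix Q Q ℂ) (F' : Pairs n N → Pairs n N → Matrix Q' Q' ℂ)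
    (i : ℕ) (z : Fin N → Round n) : ℝ :=
  expectation v (marginal F i (fun j => (z j).1) (fun j => (z j).2.1) ⊗ₖ
    marginal F' i (fun j => (z j).1) (fun j => (z j).2.2))

variable {A B A' B' : Type*} [Fintype A] [DecidableEq A] [Fintype B] [DecidableEq B]
  [Fintype A'] [DecidableEq A'] [Fintype B'] [DecidableEq B']

lemma sum_roundFactor_mul_eq (G : BellGame n) (l δ : ℝ) (w : Round n → ℝ) :
    ∑ a, roundFactor G l δ a * w a = ((n : ℝ) ^ 2)⁻¹ * ∑ x, ∑ y, ∑ s, ∑ t,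
      Real.exp (l * (G.score x y s t - δ)) * ∑ t', w ((x, y), (s, t), (s, t')) := by
  simp only [Fintype.sum_prod_type, roundFactor, Finset.mul_sum, mul_ite, ite_mul, mul_zero,
    zero_mul, mul_assoc]
  refine Finset.sum_congr rfl fun x _ => Finset.sum_congr rfl fun y _ =>
    Finset.sum_congr rfl fun s _ => Finset.sum_congr rfl fun t _ => ?_
  rw [Finset.sum_comm]
  simp only [Finset.sum_ite_eq, Finset.mem_univ, if_true]

lemma sum_roundFactor_mul_historyWeight_update_le (hn : 0 < n) (G : BellGame n) {δ : ℝ}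
    (hδ : 0 < δ) (hδ1 : δ ≤ 1) (v : (A × B) × (A' × B') → ℂ)
    {F : Pairs n N → Pairs n N → Matrix (A × B) (A × B) ℂ}
    {F' : Pairs n N → Pairs n N → Matrix (A' × B') (A' × B') ℂ} (hF : HasLocalRounds F)
    (hF' : HasLocalRounds F') (i : Fin N) (z : Fin N → Round n) :
    ∑ a, roundFactor G (δ / (16 * n ^ 2)) δ a *
        historyWeight v F F' (i + 1) (Function.update z i a) ≤
      (1 - δ ^ 2 / (32 * n ^ 2)) * historyWeight v F F' i z := by
  obtain ⟨K, P, R, hK, hP, hR, hsucc⟩ := hF i (fun j => (z j).1) fun j => (z j).2.1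
  obtain ⟨K', P', R', hK', hP', hR', hsucc'⟩ := hF' i (fun j => (z j).1) fun j => (z j).2.2
  have hpast : historyWeight v F F' i z = expectation ((K ⊗ₖ K') *ᵥ v) 1 := by
    rw [historyWeight, ← hK, ← hK', expectation_mulVec, mul_one, Matrix.conjTranspose_kronecker,
      Matrix.mul_kronecker_mul]
  have hnext (x y s t t' : Fin n) :
      historyWeight v F F' (i + 1) (Function.update z i ((x, y), (s, t), (s, t'))) =
        expectation ((K ⊗ₖ K') *ᵥ v) ((P x s ⊗ₖ R y t) ⊗ₖ (P' x s ⊗ₖ R' y t')) := by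
    have hcomp {β : Type} (f : Round n → β) :
        (fun j => f (Function.update z i ((x, y), (s, t), (s, t')) j)) =
          Function.update (fun j => f (z j)) i (f ((x, y), (s, t), (s, t'))) :=
      Function.comp_update f z i _
    rw [historyWeight, hcomp Prod.fst, hcomp fun a => a.2.1, hcomp fun a => a.2.2, hsucc, hsucc',
      expectation_mulVec, Matrix.conjTranspose_kronecker, Matrix.mul_kronecker_mul,
      Matrix.mul_kronecker_mul]
  have hn2 : (0 : ℝ) < (n : ℝ) ^ 2 := by positivity
  rw [sum_roundFactor_mul_eq, inv_mul_le_iff₀ hn2, hpast]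
  simp only [hnext]
  exact (sum_exp_mul_expectation_kronecker_le hn G hP hR hP' hR' _ hδ hδ1).trans_eq (by ring)

lemma sum_prod_roundFactor_mul_historyWeight_le (hn : 0 < n) (G : BellGame n) {δ : ℝ}
    (hδ : 0 < δ) (hδ1 : δ ≤ 1) (v : (A × B) × (A' × B') → ℂ)
    {F : Pairs n N → Pairs n N → Matrix (A × B) (A × B) ℂ}
    {F' : Pairs n N → Pairs n N → Matrix (A' × B') (A' × B') ℂ} (hF : HasLocalRounds F)
    (hF' : HasLocalRounds F') (d : Fin N → Round n) :
    ∑ z, (∏ j, roundFactor G (δ / (16 * n ^ 2)) δ (z j)) * historyWeight v F F' N z ≤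
      (1 - δ ^ 2 / (32 * n ^ 2)) ^ N * historyWeight v F F' 0 d :=
  sum_prod_mul_le_pow_mul (roundFactor_nonneg G _ δ)
    (sub_nonneg.2 (div_sq_le_one hn hδ.le hδ1))
    (sum_roundFactor_mul_historyWeight_update_le hn G hδ hδ1 v hF hF') d

lemma inv_card_le_prod_roundFactor (hN : 0 < N) (G : BellGame n) {l δ : ℝ} (hl : 0 ≤ l)
    {z : Fin N → Round n} (hsame : ∀ j, (z j).2.1.1 = (z j).2.2.1)
    (hsucc : δ < averageScore G (fun j => (z j).1) fun j => (z j).2.1) :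
    (Fintype.card (Pairs n N) : ℝ)⁻¹ ≤ ∏ j, roundFactor G l δ (z j) := by
  have hcard : (Fintype.card (Pairs n N) : ℝ) = ((n : ℝ) ^ 2) ^ N := by
    simp [Pairs, sq]
  have hexcess : 0 ≤ ∑ j, (G.score (z j).1.1 (z j).1.2 (z j).2.1.1 (z j).2.1.2 - δ) := by
    rw [averageScore, lt_div_iff₀ (by exact_mod_cast hN)] at hsucc
    simp only [Finset.sum_sub_distrib, Finset.sum_const, Finset.card_univ, Fintype.card_fin,
      nsmul_eq_mul]
    linarith
  simp only [roundFactor, if_pos (hsame _), Finset.prod_mul_distrib, Finset.prod_const,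
    Finset.card_univ, Fintype.card_fin, ← Real.exp_sum, ← Finset.mul_sum]
  rw [hcard, inv_pow]
  exact le_mul_of_one_le_right (by positivity) (Real.one_le_exp (mul_nonneg hl hexcess))

end Histories

section Protocol

variable {n N : ℕ} {Q : Type*} [Fintype Q] [DecidableEq Q]

/-- The unit vector `(√ρ ⊗ I) ∑ₑ e ⊗ e` onto which `canonicalPurification ρ` projects. -/
def purificationVec (ρ : Matrix Q Q ℂ) : Q × Q → ℂ :=
  (cfc Real.sqrt ρ ⊗ₖ (1 : Matrix Q Q ℂ)) *ᵥ diagVec Q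

lemma expectation_purificationVec_one {ρ : Matrix Q Q ℂ} (hρ : IsState ρ) :
    expectation (purificationVec ρ) 1 = 1 := by
  have hsqrt : (cfc Real.sqrt ρ)ᴴ = cfc Real.sqrt ρ := IsSelfAdjoint.cfc
  have htrace : star (diagVec Q) ⬝ᵥ (ρ ⊗ₖ (1 : Matrix Q Q ℂ)) *ᵥ diagVec Q = ρ.trace := by
    simp [dotProduct, Matrix.mulVec, diagVec, Fintype.sum_prod_type, Matrix.one_apply,
      Matrix.trace, apply_ite]
  rw [purificationVec, expectation_mulVec, mul_one, Matrix.conjTranspose_kronecker,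
    Matrix.conjTranspose_one, ← Matrix.mul_kronecker_mul, mul_one, hsqrt,
    sqrt_mul_sqrt_self hρ.posSemidef]
  simp [expectation, htrace, hρ.trace_eq_one]

omit [DecidableEq Q] in
lemma trace_mul_vecMulVec_star (Z : Matrix Q Q ℂ) (v : Q → ℂ) :
    (Z * Matrix.vecMulVec v (star v)).trace = star v ⬝ᵥ Z *ᵥ v := by
  rw [Matrix.mul_vecMulVec, Matrix.trace_vecMulVec, dotProduct_comm]

lemma trace_single_mul_bellState (u u' : Q) :
    (Matrix.single (u, u') (u, u') (1 : ℂ) * bellState Q).trace =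
      if u = u' then (Fintype.card Q : ℂ)⁻¹ else 0 := by
  rw [bellState, Matrix.mul_smul, Matrix.trace_smul, trace_mul_vecMulVec_star,
    Matrix.single_mulVec_eq]
  by_cases h : u = u' <;> simp [diagVec, h]

lemma recordProb_eq (ρ : Matrix Q Q ℂ) (F : Pairs n N → Pairs n N → Matrix Q Q ℂ)
    (r : Record n N) : recordProb ρ F r =
      if r.inp = r.inp' then (Fintype.card (Pairs n N) : ℝ)⁻¹ * expectation (purificationVec ρ)
        (F r.inp r.out ⊗ₖ (F r.inp' r.out').map (starRingEnd ℂ)) else 0 := by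
  have hpur : canonicalPurification ρ =
      Matrix.vecMulVec (purificationVec ρ) (star (purificationVec ρ)) := rfl
  rw [recordProb, recordEffect, initialState, ← Matrix.mul_kronecker_mul, Matrix.trace_kronecker,
    Matrix.single_kronecker_single, mul_one, trace_single_mul_bellState, hpur,
    trace_mul_vecMulVec_star]
  split_ifs
  · rw [← Complex.ofReal_natCast, ← Complex.ofReal_inv, Complex.re_ofReal_mul]
    rfl
  · simp

lemma recordProb_nonneg (ρ : Matrix Q Q ℂ) {F : Pairs n N → Pairs n N → Matrix Q Q ℂ}
    (hF : ∀ u, IsMeasurement (F u)) (r : Record n N) : 0 ≤ recordProb ρ F r := by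
  rw [recordProb_eq]
  split_ifs
  · exact mul_nonneg (by positivity) (expectation_nonneg _
      (((hF _).posSemidef _).kronecker (posSemidef_map_conj ((hF _).posSemidef _))))
  · exact le_rfl

lemma prob_mono (ρ : Matrix Q Q ℂ) {F : Pairs n N → Pairs n N → Matrix Q Q ℂ}
    (hF : ∀ u, IsMeasurement (F u)) {E E' : Record n N → Prop} (h : ∀ r, E r → E' r) :
    prob ρ F E ≤ prob ρ F E' := by
  classical
  exact Finset.sum_le_sum_of_subset_of_nonneg (Finset.monotone_filter_right _ fun r _ => h r)
    fun r _ _ => recordProb_nonneg ρ hF r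

lemma averageScore_le_one (G : BellGame n) (u t : Pairs n N) : averageScore G u t ≤ 1 := by
  refine div_le_one_of_le₀ ?_ N.cast_nonneg
  calc ∑ i, G.score (u i).1 (u i).2 (t i).1 (t i).2
      ≤ ∑ _i : Fin N, (1 : ℝ) := Finset.sum_le_sum fun i _ => (G.score_mem _ _ _ _).2
    _ = N := by simp

lemma prob_le_of_le_one_imp {ρ : Matrix Q Q ℂ} {F : Pairs n N → Pairs n N → Matrix Q Q ℂ}
    {G : BellGame n} {δ p : ℝ} {E : Record n N → Prop} (hE : ∀ r, E r → RefereeSucc G δ r)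
    (hp : 0 ≤ p) (h : δ ≤ 1 → prob ρ F E ≤ p) : prob ρ F E ≤ p := by
  rcases le_or_gt δ 1 with hδ | hδ
  · exact h hδ
  · have hempty (r : Record n N) : ¬ E r := fun hr =>
      ((hE r hr).trans_le (averageScore_le_one G _ _)).not_gt hδ
    simpa only [prob, hempty, Finset.filter_false, Finset.sum_empty] using hp

/-- The record of a history, in which the adversary has the same inputs as the devices. -/
def historyRecord (z : Fin N → Round n) : Record n N where
  inp j := (z j).1
  out j := (z j).2.1
  inp' j := (z j).1
  out' j := (z j).2.2

lemma historyRecord_injective : Function.Injective (historyRecord (n := n) (N := N)) := by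
  intro z z' h
  simp only [historyRecord, Record.mk.injEq, funext_iff] at h
  exact funext fun j => Prod.ext (h.1 j) (Prod.ext (h.2.1 j) (h.2.2.2 j))

lemma mem_range_historyRecord {r : Record n N} (hr : r.inp = r.inp') :
    r ∈ Set.range (historyRecord (n := n) (N := N)) :=
  ⟨fun j => (r.inp j, r.out j, r.out' j), by
    obtain ⟨inp, out, inp', out'⟩ := r
    obtain rfl : inp = inp' := hr
    rfl⟩

open Classical in
lemma prob_eq_sum_historyWeight (ρ : Matrix Q Q ℂ) (F : Pairs n N → Pairs n N → Matrix Q Q ℂ)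
    (E : Record n N → Prop) :
    prob ρ F E = ∑ z, if E (historyRecord z) then (Fintype.card (Pairs n N) : ℝ)⁻¹ *
      historyWeight (purificationVec ρ) F (fun u t => (F u t).map (starRingEnd ℂ)) N z else 0 := by
  rw [prob, Finset.sum_filter]
  refine (Fintype.sum_of_injective historyRecord historyRecord_injective _ _ (fun r hr => ?_)
    fun z => ?_).symm
  · rw [recordProb_eq, if_neg (mt mem_range_historyRecord hr), ite_self]
  · simp only [recordProb_eq, historyWeight, marginal_all, historyRecord, if_true]

variable {A B : Type*} [Fintype A] [DecidableEq A] [Fintype B] [DecidableEq B]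

lemma prob_sameOutput_and_refereeSucc_le_pow (hn : 0 < n) (G : BellGame n) {δ : ℝ} (hδ : 0 < δ)
    (hδ1 : δ ≤ 1) (hN : 0 < N) {ρ : Matrix (A × B) (A × B) ℂ} (hρ : IsState ρ)
    {F : Pairs n N → Pairs n N → Matrix (A × B) (A × B) ℂ} (hF : IsBipartiteSequential F) :
    prob ρ F (fun r => SameOutput r ∧ RefereeSucc G δ r) ≤
      (1 - δ ^ 2 / (32 * n ^ 2)) ^ N := by
  have hstart (z : Fin N → Round n) : historyWeight (purificationVec ρ) F
      (fun u t => (F u t).map (starRingEnd ℂ)) 0 z = 1 := by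
    rw [historyWeight, marginal_map_conj, hF.isSequential.marginal_zero,
      hF.isSequential.marginal_zero, Matrix.map_one _ (map_zero _) (map_one _),
      Matrix.one_kronecker_one, expectation_purificationVec_one hρ]
  have hend (z : Fin N → Round n) : 0 ≤ historyWeight (purificationVec ρ) F
      (fun u t => (F u t).map (starRingEnd ℂ)) N z := by
    rw [historyWeight, marginal_map_conj]
    exact expectation_nonneg _ ((hF.isSequential.posSemidef_marginal _ _ _).kronecker
      (posSemidef_map_conj (hF.isSequential.posSemidef_marginal _ _ _)))
  have hmoment := sum_prod_roundFactor_mul_historyWeight_le hn G hδ hδ1 (purificationVec ρ)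
    hF.hasLocalRounds hF.hasLocalRounds.map_conj
    fun _ => ((⟨0, hn⟩, ⟨0, hn⟩), (⟨0, hn⟩, ⟨0, hn⟩), (⟨0, hn⟩, ⟨0, hn⟩))
  rw [hstart, mul_one] at hmoment
  rw [prob_eq_sum_historyWeight]
  refine (Finset.sum_le_sum fun z _ => ?_).trans hmoment
  split_ifs with hE
  · exact mul_le_mul_of_nonneg_right
      (inv_card_le_prod_roundFactor hN G (by positivity) hE.1 hE.2) (hend z)
  · exact mul_nonneg (Finset.prod_nonneg fun j _ => roundFactor_nonneg G _ δ _) (hend z)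

end Protocol

lemma one_sub_pow_le_exp_neg {x : ℝ} (hx : x ≤ 1) (N : ℕ) :
    (1 - x) ^ N ≤ Real.exp (-(N * x)) := by
  rw [← mul_neg, Real.exp_nat_mul]
  exact pow_le_pow_left₀ (sub_nonneg.2 hx) (Real.one_sub_le_exp_neg x) N

lemma pow_six_div_pow_four_le_sq_div_sq {n : ℕ} (hn : 0 < n) {δ : ℝ} (hδ : 0 ≤ δ)
    (hδ1 : δ ≤ 1) : δ ^ 6 / (n : ℝ) ^ 4 ≤ δ ^ 2 / (n : ℝ) ^ 2 :=
  have hn1 : (1 : ℝ) ≤ n := by exact_mod_cast hn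
  div_le_div₀ (by positivity) (pow_le_pow_of_le_one hδ hδ1 (by norm_num)) (by positivity)
    (pow_le_pow_right₀ hn1 (by norm_num))

end MirrorProtocol

end

theorem mainTheorem2_general {n : ℕ} (hn : 0 < n) (G : MirrorProtocol.BellGame n) {δ : ℝ}
    (hδ : 0 < δ) {N : ℕ} (hN : 0 < N) {A B : Type*} [Fintype A] [DecidableEq A] [Fintype B]
    [DecidableEq B] {ρ : Matrix (A × B) (A × B) ℂ} (hρ : MirrorProtocol.IsState ρ)
    {F : (Fin N → Fin n × Fin n) → (Fin N → Fin n × Fin n) → Matrix (A × B) (A × B) ℂ}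
    (hF : MirrorProtocol.IsBipartiteSequential F) :
    MirrorProtocol.prob ρ F
        (fun r => MirrorProtocol.SameOutput r ∧ MirrorProtocol.RefereeSucc G δ r) ≤
      Real.exp (-(N * (δ ^ 2 / (32 * (n : ℝ) ^ 2)))) :=
  MirrorProtocol.prob_le_of_le_one_imp (fun _ hr => hr.2) (Real.exp_pos _).le fun hδ1 =>
    (MirrorProtocol.prob_sameOutput_and_refereeSucc_le_pow hn G hδ hδ1 hN hρ hF).trans
      (MirrorProtocol.one_sub_pow_le_exp_neg
        (MirrorProtocol.div_sq_le_one hn hδ.le hδ1) N)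

theorem mainTheorem2 :
    ∃ c : ℝ, 0 < c ∧
      ∀ (n : ℕ), 0 < n → ∀ (G : MirrorProtocol.BellGame n) (δ : ℝ), 0 < δ →
      ∀ (N : ℕ), 0 < N →
      ∀ (A B : Type*) [Fintype A] [DecidableEq A] [Fintype B] [DecidableEq B]
        (ρ : Matrix (A × B) (A × B) ℂ), MirrorProtocol.IsState ρ →
      ∀ (F : (Fin N → Fin n × Fin n) → (Fin N → Fin n × Fin n) → Matrix (A × B) (A × B) ℂ),
        MirrorProtocol.IsBipartiteSequential F →
        MirrorProtocol.prob ρ F (fun r => MirrorProtocol.SameOutput r ∧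
            MirrorProtocol.RefereeSucc G δ r ∧ MirrorProtocol.AdversarySucc G δ r) ≤
          Real.exp (-(c * ((N : ℝ) * δ ^ 6 / (n : ℝ) ^ 4))) := by
  refine ⟨1 / 32, by norm_num, fun n hn G δ hδ N hN A B _ _ _ _ ρ hρ F hF =>
    MirrorProtocol.prob_le_of_le_one_imp (fun r hr => hr.2.1) (Real.exp_pos _).le fun hδ1 => ?_⟩
  refine (MirrorProtocol.prob_mono ρ hF.isSequential.isMeasurement
    fun r hr => ⟨hr.1, hr.2.1⟩).trans ((mainTheorem2_general hn G hδ hN hρ hF).trans ?_)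
  rw [Real.exp_le_exp, neg_le_neg_iff]
  calc 1 / 32 * (N * δ ^ 6 / (n : ℝ) ^ 4) = N / 32 * (δ ^ 6 / (n : ℝ) ^ 4) := by ring
    _ ≤ N / 32 * (δ ^ 2 / (n : ℝ) ^ 2) := mul_le_mul_of_nonneg_left
        (MirrorProtocol.pow_six_div_pow_four_le_sq_div_sq hn hδ.le hδ1) (by positivity)
    _ = N * (δ ^ 2 / (32 * (n : ℝ) ^ 2)) := by ring
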